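/- Let $k$ be a number field, let $X$ and $Y$ be quasi-projective varieties over $k$ (possibly reducible), and let $\pi : Y \to X$ be a finite dominant morphism over $k$. For a field embedding $\varphi : k \hookrightarrow \mathbb{C}$ write $\pi_\varphi : Y_\varphi(\mathbb{C}) \to X_\varphi(\mathbb{C})$ for the map induced on complex points, with their classical topology, by the base change of $\pi$ along $\varphi$. A continuous surjective map $f : E \to B$ of topological spaces is called an (unramified) topological cover if every $b \in B$ has an open neighbourhood $U$ for which there are a discrete space $F$ and a homeomorphism $f^{-1}(U) \cong U \times F$ compatible with the projections to $U$. (1) Fix embeddings $k \hookrightarrow \overline{\mathbb{Q}} \hookrightarrow \mathbb{C}$ and let $\sigma \in \mathrm{Gal}(\overline{\mathbb{Q}}/\mathbb{Q})$. Let $\pi^\sigma : Y^\sigma \to X^\sigma$ be the conjugate morphism of varieties over $\sigma(k) \subseteq \overline{\mathbb{Q}}$, obtained by applying $\sigma$ to the coefficients of the defining equations (that is, by base change along $\sigma|_k : k \to \sigma(k)$). Then $\pi : Y(\mathbb{C}) \to X(\mathbb{C})$ is an unramified topological cover if and only if $\pi^\sigma : Y^\sigma(\mathbb{C}) \to X^\sigma(\mathbb{C})$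 is one, where complex points are taken with respect to the given embeddings of $k$ and of $\sigma(k)$ in $\mathbb{C}$. (2) Consequently, being a topological cover does not depend on the complex embedding of $k$: for any two embeddings $\varphi, \psi : k \hookrightarrow \mathbb{C}$, the map $\pi_\varphi$ is an unramified topological cover if and only if $\pi_\psi$ is one. -/

import Mathlib

open CategoryTheory AlgebraicGeometry

noncomputable section

namespace ChevalleyWeil

/-- Projective `n`-space over a field `k`, as a scheme over `Spec k`. -/
def projectiveSpace (k : Type) [Field k] (n : ℕ) : Over (Spec (.of k)) :=
  letI : GradedAlgebra (MvPolynomial.homogeneousSubmodule (Fin (n + 1)) k) :=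
    MvPolynomial.gradedAlgebra
  Over.mk (Proj.toSpecZero (MvPolynomial.homogeneousSubmodule (Fin (n + 1)) k) ≫
    Spec.map (CommRingCat.ofHom
      (algebraMap k (MvPolynomial.homogeneousSubmodule (Fin (n + 1)) k 0))))

/-- A `k`-scheme is quasi-projective if it is isomorphic to a locally closed subscheme of some
projective space over `k`. Reducible (even non-reduced or empty) schemes are allowed. -/
def IsQuasiProjective {k : Type} [Field k] (X : Over (Spec (.of k))) : Prop :=
  ∃ (n : ℕ) (i : X ⟶ projectiveSpace k n), IsImmersion i.left

/-- Extension of scalars along a homomorphism of fields `φ : K → L`; this replaces the defining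
equations of a `K`-variety (and of a morphism) by the equations with coefficients transformed
by `φ`. -/
def baseChange {K L : Type} [Field K] [Field L] (φ : K →+* L) :
    Over (Spec (.of K)) ⥤ Over (Spec (.of L)) :=
  Over.pullback (Spec.map (CommRingCat.ofHom φ))

/-- Let the field `k` be embedded in `Ω` by `ι`, and let `σ` be an automorphism of `Ω`. This is the
functor which sends a `k`-variety `X` to the conjugate variety `X^σ`, defined over the image
`σ(k) ⊆ Ω`, and a morphism `π` to the conjugate morphism `π^σ`. -/
def conjugate {k Ω : Type} [Field k] [Field Ω] (ι : k →+* Ω) (σ : Ω →+* Ω) :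
    Over (Spec (.of k)) ⥤ Over (Spec (.of (σ.comp ι).fieldRange)) :=
  baseChange (σ.comp ι).rangeRestrictField

/-- The set `Z(ℂ)` of complex points of a scheme `Z` over `ℂ`: the sections of `Z → Spec ℂ`. -/
def ComplexPoints (Z : Over (Spec (.of ℂ))) : Type :=
  Over.mk (𝟙 (Spec (.of ℂ))) ⟶ Z

/-- The value of a regular function `f` on a scheme `U` at a point `y : Spec ℂ ⟶ U`. -/
def evalAt {U : Scheme.{0}} (y : Spec (.of ℂ) ⟶ U) (f : Γ(U, ⊤)) : ℂ :=
  (Scheme.ΓSpecIso (.of ℂ)).hom.hom (y.appTop.hom f)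

/-- The set of the complex points `p` that lie in the Zariski open set `U` and at which the value
of the regular function `f` on `U` belongs to `V`. -/
def ComplexPoints.basicSet {Z : Over (Spec (.of ℂ))} (U : Z.left.Opens) (f : Γ(U, ⊤))
    (V : Set ℂ) : Set (ComplexPoints Z) :=
  {p | ∃ y : Spec (.of ℂ) ⟶ U, y ≫ U.ι = p.left ∧ evalAt y f ∈ V}

/-- The classical (complex) topology on `Z(ℂ)`: the coarsest topology for which `U(ℂ)` is open for
each Zariski open `U`, and each regular function on `U` is continuous on `U(ℂ)`. -/
instance (Z : Over (Spec (.of ℂ))) : TopologicalSpace (ComplexPoints Z) :=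
  TopologicalSpace.generateFrom
    {S | ∃ (U : Z.left.Opens) (f : Γ(U, ⊤)) (V : Set ℂ), IsOpen V ∧
      S = ComplexPoints.basicSet U f V}

/-- The map `Y(ℂ) → X(ℂ)` induced by a morphism `Y → X` of schemes over `ℂ`. -/
def complexPointsMap {Y X : Over (Spec (.of ℂ))} (π : Y ⟶ X) : ComplexPoints Y → ComplexPoints X :=
  fun p => p ≫ π

/-- A (unramified) topological cover: a continuous surjective map which is locally on the target
the projection from a product with a discrete space. -/
def IsTopologicalCover {E B : Type} [TopologicalSpace E] [TopologicalSpace B] (f : E → B) : Prop :=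
  Continuous f ∧ Function.Surjective f ∧ IsCoveringMap f

end ChevalleyWeil

end

open Filter Topology TensorProduct

noncomputable section

namespace ChevalleyWeil

/-! Two embeddings of a number field in `ℂ` differ by an automorphism `τ` of `ℂ`
(`exists_ringEquiv_comp_eq`), usually discontinuous. Up to isomorphism, base change along `τ` keeps
the scheme, its open sets and its rings of sections, and changes only the structure map to `Spec ℂ`.
Hence it suffices to characterise covers by conditions on kernels of complex points, because
composing a point with `τ` does not change its kernel.

On complex points a finite morphism is closed with finite fibres, since roots of monic polynomials
stay bounded. It is therefore a covering map iff it is a local homeomorphism, that is, locally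
injective and open at each point (`isCoveringMap_restrict_iff`). Each of the two properties says
that certain points avoid the Zariski closure of a constructible set. Local injectivity at `y`: the
diagonal point `(y, y)` is not in the closure of the off-diagonal part of `Y ×_X Y`. Openness at
`y`: if it fails, take a function `b` separating `y` from the rest of its fibre. Along some
ultrafilter tending to the image `x` of `y`, the values of `b` on the fibres stay away from `b(y)`.
They are bounded in number and in size, so they converge to a tuple `v` with no entry `b(y)`. Thus
`(x, v)` is a limit of points of `X × 𝔸ⁿ` whose coordinates include every value of `b` on the fibre,
and by Chevalley's theorem such points form a constructible set.

The bridge is `AffinePoints.frequently_mem_iff`: constructible sets have the same Zariski and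
classical closure at complex points. It rests on the classical density of non-empty Zariski open
sets in an irreducible variety (`frequently_ne_zero`), which Noether normalization reduces to affine
space, finite maps to a normal base being open (`nhds_le_map_restrict`). -/

/-- The complex points of the spectrum of a `ℂ`-algebra. -/
def AffinePoints (C : Type*) [CommRing C] [Algebra ℂ C] : Type _ := C →ₐ[ℂ] ℂ

/-! ### Complex points of affine schemes and properness of integral extensions -/

namespace AffinePoints

variable {A B C : Type*} [CommRing A] [CommRing B] [CommRing C]
  [Algebra ℂ A] [Algebra ℂ B] [Algebra ℂ C] [Algebra A B] [IsScalarTower ℂ A B]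

instance : FunLike (AffinePoints C) C ℂ := inferInstanceAs (FunLike (C →ₐ[ℂ] ℂ) C ℂ)

instance : AlgHomClass (AffinePoints C) ℂ C ℂ :=
  inferInstanceAs (AlgHomClass (C →ₐ[ℂ] ℂ) ℂ C ℂ)

/-- The topology of pointwise convergence. -/
instance : TopologicalSpace (AffinePoints C) :=
  TopologicalSpace.induced (fun x c ↦ x c) inferInstance

@[ext]
lemma ext {x y : AffinePoints C} (h : ∀ c, x c = y c) : x = y := DFunLike.ext _ _ h

lemma isInducing_coe : IsInducing (fun (x : AffinePoints C) (c : C) ↦ x c) := ⟨rfl⟩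

@[fun_prop]
lemma continuous_eval (c : C) : Continuous fun x : AffinePoints C ↦ x c :=
  (continuous_apply c).comp isInducing_coe.continuous

lemma continuous_iff {T : Type*} [TopologicalSpace T] {f : T → AffinePoints C} :
    Continuous f ↔ ∀ c, Continuous fun t ↦ f t c := by
  rw [isInducing_coe.continuous_iff, continuous_pi_iff]
  rfl

lemma tendsto_nhds_iff {T : Type*} {l : Filter T} {f : T → AffinePoints C} {x : AffinePoints C} :
    Tendsto f l (𝓝 x) ↔ ∀ c, Tendsto (fun t ↦ f t c) l (𝓝 (x c)) := by
  rw [isInducing_coe.tendsto_nhds_iff, tendsto_pi_nhds]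
  rfl

instance : T2Space (AffinePoints C) :=
  T2Space.of_injective_continuous (f := fun x c ↦ x c) (fun _ _ h ↦ ext (congr_fun h))
    isInducing_coe.continuous

/-- The map on complex points induced by a homomorphism of `ℂ`-algebras. -/
def comap (φ : A →ₐ[ℂ] C) (x : AffinePoints C) : AffinePoints A := AlgHom.comp (x : C →ₐ[ℂ] ℂ) φ

@[simp]
lemma comap_apply (φ : A →ₐ[ℂ] C) (x : AffinePoints C) (a : A) : comap φ x a = x (φ a) := rfl

@[fun_prop]
lemma continuous_comap (φ : A →ₐ[ℂ] C) : Continuous (comap φ) :=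
  continuous_iff.mpr fun a ↦ continuous_eval (φ a)

variable (A) in
/-- The restriction of a complex point of an `A`-algebra to `A`. -/
def restrict (x : AffinePoints B) : AffinePoints A := comap (IsScalarTower.toAlgHom ℂ A B) x

@[simp]
lemma restrict_apply (x : AffinePoints B) (a : A) : restrict A x a = x (algebraMap A B a) := rfl

@[fun_prop]
lemma continuous_restrict : Continuous (restrict A : AffinePoints B → AffinePoints A) :=
  continuous_comap _

lemma eval_eq (x : AffinePoints B) (P : Polynomial A) (b : B) :
    x (Polynomial.aeval b P) = (P.map (restrict A x : A →+* ℂ)).eval (x b) := by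
  rw [Polynomial.aeval_def, Polynomial.eval_map, ← RingHom.coe_coe, Polynomial.hom_eval₂]
  rfl

/-- A pointwise limit of complex points is a complex point. -/
lemma exists_tendsto {T : Type*} {l : Filter T} [l.NeBot] {f : T → AffinePoints C}
    (h : ∀ c, ∃ v, Tendsto (fun t ↦ f t c) l (𝓝 v)) : ∃ x, Tendsto f l (𝓝 x) := by
  choose g hg using h
  have e {c : C} {v : ℂ} (h : Tendsto (fun t ↦ f t c) l (𝓝 v)) : g c = v :=
    tendsto_nhds_unique (hg c) h
  refine ⟨(AlgHom.mk' (RingHom.mk' ⟨⟨g, ?_⟩, ?_⟩ ?_) ?_ : C →ₐ[ℂ] ℂ), tendsto_nhds_iff.mpr hg⟩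
  · exact e (by simp)
  · exact fun a b ↦ e (by simpa using (hg a).mul (hg b))
  · exact fun a b ↦ e (by simpa using (hg a).add (hg b))
  · exact fun a b ↦ e (c := a • b) (v := a * g b) (by simpa using (hg b).const_mul a)

/-- The roots of a monic polynomial remain bounded as long as its coefficients do. -/
lemma exists_norm_eval_le [Algebra.IsIntegral A B] {l : Filter (AffinePoints B)}
    {x : AffinePoints A} (h : Tendsto (restrict A) l (𝓝 x)) (b : B) :
    ∃ M : ℝ, ∀ᶠ z in l, ‖z b‖ ≤ M := by
  obtain ⟨P, hP, hb⟩ := Algebra.IsIntegral.isIntegral (R := A) b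
  obtain ⟨K, hK⟩ : ∃ K : ℝ, ∀ i ∈ Finset.range P.natDegree, ‖x (P.coeff i)‖ < K := by
    obtain ⟨K, hK⟩ := ((Finset.range P.natDegree).image fun i ↦ ‖x (P.coeff i)‖).finite_toSet.bddAbove
    refine ⟨K + 1, fun i hi ↦ (hK ?_).trans_lt (lt_add_one K)⟩
    exact Finset.mem_coe.mpr (Finset.mem_image_of_mem _ hi)
  have hev : ∀ᶠ z in l, ∀ i ∈ Finset.range P.natDegree, ‖restrict A z (P.coeff i)‖ < K := by
    rw [Filter.eventually_all_finset]
    exact fun i hi ↦ ((tendsto_nhds_iff.mp h (P.coeff i)).norm).eventually_lt_const (hK i hi)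
  -- This is the Cauchy bound of a monic polynomial: one plus the largest lower coefficient.
  refine ⟨Real.toNNReal K + 1, hev.mono fun z hz ↦ ?_⟩
  have hm := hP.map (restrict A z : A →+* ℂ)
  have hr : (P.map (restrict A z : A →+* ℂ)).IsRoot (z b) := by
    rw [Polynomial.IsRoot.def, ← eval_eq, Polynomial.aeval_def, hb, map_zero]
  have hs : (Finset.range (P.map (restrict A z : A →+* ℂ)).natDegree).sup
      (fun i ↦ ‖(P.map (restrict A z : A →+* ℂ)).coeff i‖₊) ≤ K.toNNReal := by
    refine Finset.sup_le fun i hi ↦ ?_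
    rw [hP.natDegree_map] at hi
    rw [← NNReal.coe_le_coe, Polynomial.coeff_map]
    exact (hz i hi).le.trans (Real.le_coe_toNNReal K)
  have hc := (Polynomial.IsRoot.norm_lt_cauchyBound hm.ne_zero hr).le
  rw [Polynomial.cauchyBound, hm.leadingCoeff, nnnorm_one, div_one] at hc
  exact_mod_cast hc.trans (add_le_add_left hs 1)

/-- An integral extension induces a proper map on complex points. -/
lemma exists_le_nhds_of_isIntegral [Algebra.IsIntegral A B] {l : Ultrafilter (AffinePoints B)}
    {x : AffinePoints A} (h : Tendsto (restrict A) (l : Filter (AffinePoints B)) (𝓝 x)) :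
    ∃ y, restrict A y = x ∧ (l : Filter (AffinePoints B)) ≤ 𝓝 y := by
  -- Each coordinate stays in a compact disc along `l`, so its pushforward ultrafilter converges.
  obtain ⟨y, hy⟩ := exists_tendsto (f := fun z : AffinePoints B ↦ z) (l := (l : Filter (AffinePoints B))) fun b ↦ by
    obtain ⟨M, hM⟩ := exists_norm_eval_le h b
    obtain ⟨v, -, hv⟩ := (isCompact_closedBall (0 : ℂ) M).ultrafilter_le_nhds
      (l.map fun z ↦ z b) (by
        rw [Filter.le_principal_iff]
        exact hM.mono fun z hz ↦ by simpa using hz)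
    exact ⟨v, hv⟩
  exact ⟨y, tendsto_nhds_unique (continuous_restrict.continuousAt.tendsto.comp hy) h, hy⟩

lemma isClosedMap_restrict [Algebra.IsIntegral A B] :
    IsClosedMap (restrict A : AffinePoints B → AffinePoints A) := by
  refine (isProperMap_iff_ultrafilter.mpr ⟨continuous_restrict, fun l x h ↦ ?_⟩).isClosedMap
  exact exists_le_nhds_of_isIntegral h

end AffinePoints

/-! ### Lifting points, finite fibres, separating functions -/

/-- A homomorphism onto an algebraically closed field extends to an integral extension, with
prescribed kernel. -/
lemma exists_ringHom_extension {R S L : Type*} [CommRing R] [CommRing S] [Algebra R S]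
    [Algebra.IsIntegral R S] [Field L] [IsAlgClosed L] (p : R →+* L) (hp : Function.Surjective p)
    (Q : Ideal S) [Q.IsPrime] (hQ : Q.comap (algebraMap R S) = RingHom.ker p) :
    ∃ z : S →+* L, z.comp (algebraMap R S) = p ∧ RingHom.ker z = Q := by
  have : (RingHom.ker p).IsMaximal := RingHom.ker_isMaximal_of_surjective p hp
  have : Q.IsMaximal := Ideal.isMaximal_of_isIntegral_of_isMaximal_comap (R := R) Q (hQ ▸ this)
  let := Ideal.Quotient.field Q
  let g : R ⧸ RingHom.ker p →+* S ⧸ Q := Ideal.Quotient.lift _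
    ((Ideal.Quotient.mk Q).comp (algebraMap R S)) fun a ha ↦ by
      rw [← hQ] at ha
      exact Ideal.Quotient.eq_zero_iff_mem.mpr ha
  -- The field `S ⧸ Q` is integral over `L ≃ R ⧸ ker p`, hence equal to it as `L` is algebraically
  -- closed; reduction modulo `Q` is then the required extension.
  let f : L →+* S ⧸ Q := g.comp (RingHom.quotientKerEquivOfSurjective hp).symm
  have hf : f.comp p = (Ideal.Quotient.mk Q).comp (algebraMap R S) := by
    ext a
    have : (RingHom.quotientKerEquivOfSurjective hp).symm (p a) = Ideal.Quotient.mk _ a := by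
      rw [RingEquiv.symm_apply_eq]
      rfl
    simp [f, this, g]
  have hi : f.IsIntegral := by
    refine RingHom.IsIntegral.tower_top p f ?_
    rw [hf]
    exact RingHom.IsIntegral.trans _ _ (algebraMap_isIntegral_iff.mpr inferInstance)
      (RingHom.isIntegral_of_surjective _ Ideal.Quotient.mk_surjective)
  let := f.toAlgebra
  have : Algebra.IsIntegral L (S ⧸ Q) := ⟨hi⟩
  have hb := IsAlgClosed.algebraMap_bijective_of_isIntegral (k := L) (K := S ⧸ Q)
  let e := RingEquiv.ofBijective f hb
  refine ⟨(e.symm : S ⧸ Q →+* L).comp (Ideal.Quotient.mk Q), ?_, ?_⟩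
  · rw [RingHom.comp_assoc, ← hf]
    ext a
    exact e.symm_apply_apply (p a)
  · ext b
    simp [RingHom.mem_ker, Ideal.Quotient.eq_zero_iff_mem]

namespace AffinePoints

variable {A B C : Type*} [CommRing A] [CommRing B] [CommRing C]
  [Algebra ℂ A] [Algebra ℂ B] [Algebra ℂ C] [Algebra A B] [IsScalarTower ℂ A B]

lemma surjective_coe (x : AffinePoints C) : Function.Surjective (x : C →+* ℂ) := fun v ↦
  ⟨algebraMap ℂ C v, AlgHomClass.commutes x v⟩

lemma ext_of_ker_le {x y : AffinePoints C}
    (h : RingHom.ker (x : C →+* ℂ) ≤ RingHom.ker (y : C →+* ℂ)) : x = y := by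
  ext c
  have : c - algebraMap ℂ C (x c) ∈ RingHom.ker (x : C →+* ℂ) := by
    simp [RingHom.mem_ker, AlgHomClass.commutes]
  have := h this
  rw [RingHom.mem_ker, map_sub, sub_eq_zero, RingHom.coe_coe, AlgHomClass.commutes] at this
  exact this.symm

/-- The complex point given by a homomorphism that is compatible with a point of the base. -/
def ofRingHom (x : AffinePoints A) (z : B →+* ℂ) (h : z.comp (algebraMap A B) = x) :
    AffinePoints B :=
  (AlgHom.mk z fun v ↦ by
    have := congr($h (algebraMap ℂ A v))
    rw [RingHom.comp_apply, ← IsScalarTower.algebraMap_apply] at this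
    exact this.trans (AlgHomClass.commutes x v) : B →ₐ[ℂ] ℂ)

@[simp]
lemma ofRingHom_apply (x : AffinePoints A) (z : B →+* ℂ) (h : z.comp (algebraMap A B) = x)
    (b : B) : ofRingHom x z h b = z b := rfl

@[simp]
lemma restrict_ofRingHom (x : AffinePoints A) (z : B →+* ℂ) (h : z.comp (algebraMap A B) = x) :
    restrict A (ofRingHom x z h) = x := by
  ext a
  exact congr($h a)

lemma exists_restrict_eq [Algebra.IsIntegral A B] (x : AffinePoints A) (Q : Ideal B) [Q.IsPrime]
    (hQ : Q.comap (algebraMap A B) = RingHom.ker (x : A →+* ℂ)) :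
    ∃ z : AffinePoints B, restrict A z = x ∧ RingHom.ker (z : B →+* ℂ) = Q := by
  obtain ⟨z, h, hz⟩ := exists_ringHom_extension (x : A →+* ℂ) x.surjective_coe Q hQ
  exact ⟨ofRingHom x z h, by simp, hz⟩

lemma finite_eval_fiber [Algebra.IsIntegral A B] (x : AffinePoints A) (b : B) :
    ((fun z : AffinePoints B ↦ z b) '' {z | restrict A z = x}).Finite := by
  obtain ⟨P, hP, hb⟩ := Algebra.IsIntegral.isIntegral (R := A) b
  refine (P.map (x : A →+* ℂ)).roots.toFinset.finite_toSet.subset ?_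
  rintro _ ⟨z, rfl, rfl⟩
  simp only [Finset.mem_coe, Multiset.mem_toFinset]
  rw [Polynomial.mem_roots (hP.map _).ne_zero, Polynomial.IsRoot.def, ← eval_eq,
    Polynomial.aeval_def, hb, map_zero]

/-- A point over `x` is determined by its values at finitely many module generators, and each value
is a root of a monic polynomial depending only on `x` and the generator. -/
lemma finite_fiber [Module.Finite A B] (x : AffinePoints A) :
    (restrict A ⁻¹' {x} : Set (AffinePoints B)).Finite := by
  obtain ⟨s, hs⟩ := Module.Finite.fg_top (R := A) (M := B)
  let F (z : AffinePoints B) (b : s) : ℂ := z b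
  refine Set.Finite.of_finite_image (f := F) ?_ ?_
  · refine (Set.Finite.pi fun b : s ↦ finite_eval_fiber (B := B) x b).subset ?_
    rintro _ ⟨z, hz, rfl⟩ b -
    exact ⟨z, hz, rfl⟩
  · intro z hz z' hz' h
    ext b
    have hb : b ∈ Submodule.span A (s : Set B) := hs ▸ Submodule.mem_top
    induction hb using Submodule.span_induction with
    | mem b hb => exact congr_fun h ⟨b, hb⟩
    | zero => simp
    | add a b _ _ ha hb => rw [map_add, map_add, ha, hb]
    | smul a b _ hb =>
      have : restrict A z a = restrict A z' a := by
        rw [show restrict A z = x from hz, show restrict A z' = x from hz']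
      rw [restrict_apply, restrict_apply] at this
      rw [Algebra.smul_def, map_mul, map_mul, hb, this]

/-- A point of a finite fibre is separated from the others by a regular function. -/
lemma exists_separating [Module.Finite A B] (y : AffinePoints B) :
    ∃ b : B, y b = 0 ∧ ∀ z : AffinePoints B, restrict A z = restrict A y → z b = 0 → z = y := by
  classical
  let s := ((finite_fiber (B := B) (restrict A y)).toFinset).erase y
  by_contra! H
  -- Prime avoidance: without a separating function, the kernel of `y` would be covered by the
  -- kernels of the finitely many other points of its fibre, hence contained in one of them.
  have hsub : (RingHom.ker (y : B →+* ℂ) : Set B) ⊆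
      ⋃ z ∈ (s : Set (AffinePoints B)), RingHom.ker (z : B →+* ℂ) := by
    intro b hb
    obtain ⟨z, hz, hzb, hzy⟩ := H b hb
    simp only [Set.mem_iUnion]
    exact ⟨z, by simpa [s] using ⟨hz, hzy⟩, hzb⟩
  obtain ⟨z, hz, h⟩ := (Ideal.subset_union_prime y y fun z _ _ _ ↦ RingHom.ker_isPrime _).mp hsub
  exact Finset.ne_of_mem_erase hz (ext_of_ker_le h).symm

/-- By properness, an ultrafilter finer than the right-hand side converges to a point of the fibre
of `y` at which `b` vanishes, and `y` is the only one. So the base and the single function `b`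
control the neighbourhoods of `y`. -/
lemma nhds_eq [Algebra.IsIntegral A B] (y : AffinePoints B) (b : B) (hb : y b = 0)
    (h : ∀ z : AffinePoints B, restrict A z = restrict A y → z b = 0 → z = y) :
    𝓝 y = Filter.comap (restrict A) (𝓝 (restrict A y)) ⊓
      Filter.comap (fun z ↦ z b) (𝓝 0) := by
  refine le_antisymm (le_inf ?_ ?_) (le_iff_ultrafilter.mpr fun l hl ↦ ?_)
  · exact continuous_restrict.continuousAt.tendsto.le_comap
  · exact hb ▸ (continuous_eval b).continuousAt.tendsto.le_comap
  · obtain ⟨y', hy', hl'⟩ := exists_le_nhds_of_isIntegral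
      (tendsto_iff_comap.mpr (hl.trans inf_le_left))
    have h0 : Tendsto (fun z : AffinePoints B ↦ z b) l (𝓝 0) :=
      tendsto_iff_comap.mpr (hl.trans inf_le_right)
    rwa [← h y' hy' (tendsto_nhds_unique ((continuous_eval b).continuousAt.tendsto.mono_left hl')
      h0)]

end AffinePoints

/-! ### Openness over a normal base and density of Zariski open sets -/

/-- A monic polynomial with a small constant term has a small root. -/
lemma exists_root_norm_lt {G : Polynomial ℂ} (hG : G.Monic) {ε : ℝ} (hε : 0 ≤ ε)
    (h : ‖G.eval 0‖ < ε ^ G.natDegree) : ∃ v, G.eval v = 0 ∧ ‖v‖ < ε := by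
  by_contra! H
  have hs := IsAlgClosed.splits G
  refine h.not_ge ?_
  rw [hs.eval_eq_prod_roots_of_monic hG, ← hs.natDegree_eq_card_roots.symm]
  have : ∀ v ∈ G.roots, ε ≤ ‖v‖ := fun v hv ↦ H v (Polynomial.isRoot_of_mem_roots hv)
  generalize G.roots = s at this
  induction s using Multiset.induction with
  | empty => simp
  | cons a s ih =>
    simp only [Multiset.card_cons, Multiset.map_cons, Multiset.prod_cons, norm_mul, pow_succ',
      zero_sub, norm_neg]
    exact mul_le_mul (this a (Multiset.mem_cons_self a s))
      (by simpa using ih fun v hv ↦ this v (Multiset.mem_cons_of_mem hv)) (by positivity)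
      (norm_nonneg _)

namespace AffinePoints

variable {A B C : Type*} [CommRing A] [CommRing B] [CommRing C]
  [Algebra ℂ A] [Algebra ℂ B] [Algebra ℂ C] [Algebra A B] [IsScalarTower ℂ A B]

/-- Over a normal base, the roots of the minimal polynomial of an element are its values on the
fibre. -/
lemma exists_eval_eq_of_minpoly [IsDomain A] [IsIntegrallyClosed A] [IsDomain B]
    [Module.IsTorsionFree A B] [Algebra.IsIntegral A B] (x : AffinePoints A) (b : B) (v : ℂ)
    (hv : ((minpoly A b).map (x : A →+* ℂ)).eval v = 0) :
    ∃ z : AffinePoints B, restrict A z = x ∧ z b = v := by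
  -- `B` is integral over `A[X]` through `X ↦ b`. As `A` is integrally closed, the kernel is
  -- generated by the minimal polynomial, so the point `(x, v)` kills it and lifts to `B` by lying
  -- over.
  let φ : Polynomial A →+* B := (Polynomial.aeval b : Polynomial A →ₐ[A] B)
  have hφC : φ.comp Polynomial.C = algebraMap A B := by ext; simp [φ]
  let p : Polynomial A →+* ℂ := Polynomial.eval₂RingHom (x : A →+* ℂ) v
  have hp : Function.Surjective p := fun w ↦ by
    obtain ⟨a, ha⟩ := x.surjective_coe w
    exact ⟨Polynomial.C a, by simpa [p] using ha⟩
  let := φ.toAlgebra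
  have hint : Algebra.IsIntegral (Polynomial A) B :=
    ⟨RingHom.IsIntegral.tower_top Polynomial.C φ (hφC ▸ algebraMap_isIntegral_iff.mpr inferInstance)⟩
  have hker : (⊥ : Ideal B).comap (algebraMap (Polynomial A) B) ≤ RingHom.ker p := by
    intro q hq
    obtain ⟨r, rfl⟩ := minpoly.isIntegrallyClosed_dvd (Algebra.IsIntegral.isIntegral b)
      (show Polynomial.aeval b q = 0 from hq)
    rw [Polynomial.eval_map] at hv
    rw [RingHom.mem_ker, Polynomial.coe_eval₂RingHom, Polynomial.eval₂_mul, hv, zero_mul]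
  have : (RingHom.ker p).IsPrime := RingHom.ker_isPrime _
  obtain ⟨Q, -, hQ, hQp⟩ := Ideal.exists_ideal_over_prime_of_isIntegral (RingHom.ker p) ⊥ hker
  obtain ⟨z, hz, -⟩ := exists_ringHom_extension p hp Q hQp
  refine ⟨ofRingHom x z ?_, restrict_ofRingHom _ _ _, ?_⟩
  · rw [← hφC, ← RingHom.comp_assoc]
    change (z.comp (algebraMap (Polynomial A) B)).comp _ = _
    rw [hz]
    ext; simp [p]
  · have := congr($hz Polynomial.X)
    simpa [p, RingHom.algebraMap_toAlgebra, φ] using this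

/-- A finite map onto a normal variety is open on complex points. -/
lemma nhds_le_map_restrict [IsDomain A] [IsIntegrallyClosed A] [IsDomain B]
    [Module.IsTorsionFree A B] [Module.Finite A B] (y : AffinePoints B) :
    𝓝 (restrict A y) ≤ Filter.map (restrict A) (𝓝 y) := by
  obtain ⟨b, hb, hsep⟩ := exists_separating (A := A) y
  intro N hN
  rw [Filter.mem_map, nhds_eq y b hb hsep, Filter.mem_inf_iff_superset] at hN
  obtain ⟨S, ⟨M, hM, hMS⟩, T, ⟨D, hD, hDT⟩, hST⟩ := hN
  obtain ⟨ε, hε, hεD⟩ := Metric.mem_nhds_iff.mp hD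
  have hF := minpoly.monic (Algebra.IsIntegral.isIntegral (R := A) b)
  -- Since `b` vanishes at `y`, the constant term of its minimal polynomial vanishes at the image of
  -- `y`. Nearby it is small, which forces a small root, and every root is a value of `b`.
  have h0 : Tendsto (fun x : AffinePoints A ↦ ‖x ((minpoly A b).coeff 0)‖) (𝓝 (restrict A y))
      (𝓝 0) := by
    have : restrict A y ((minpoly A b).coeff 0) = 0 := by
      have := eval_eq (A := A) y (minpoly A b) b
      rw [minpoly.aeval, map_zero, hb, ← Polynomial.coeff_zero_eq_eval_zero,
        Polynomial.coeff_map] at this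
      exact this.symm
    simpa [this] using ((continuous_eval ((minpoly A b).coeff 0)).norm.tendsto (restrict A y))
  filter_upwards [hM, h0.eventually_lt_const (pow_pos hε (minpoly A b).natDegree)] with x hxM hx
  obtain ⟨v, hv, hvε⟩ := exists_root_norm_lt (hF.map (x : A →+* ℂ)) hε.le (by
    rwa [hF.natDegree_map, ← Polynomial.coeff_zero_eq_eval_zero, Polynomial.coeff_map])
  obtain ⟨z, rfl, rfl⟩ := exists_eval_eq_of_minpoly x b v hv
  exact hST ⟨hMS hxM, hDT (hεD (by simpa using hvε))⟩

/-- A nonempty Zariski open subset of affine space is dense. -/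
lemma exists_eval_ne_zero {n : ℕ} {e : MvPolynomial (Fin n) ℂ} (he : e ≠ 0)
    (x : AffinePoints (MvPolynomial (Fin n) ℂ)) : ∃ᶠ p in 𝓝 x, p e ≠ 0 := by
  let F (v : Fin n → ℂ) : AffinePoints (MvPolynomial (Fin n) ℂ) := MvPolynomial.aeval v
  have hF (v) (p : MvPolynomial (Fin n) ℂ) : F v p = MvPolynomial.eval v p := by
    change MvPolynomial.aeval v p = _
    rw [MvPolynomial.aeval_eq_eval]
  have hc : Continuous F := continuous_iff.mpr fun p ↦ by
    simp_rw [hF]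
    exact MvPolynomial.continuous_eval p
  have hx : F (fun i ↦ x (MvPolynomial.X i)) = x :=
    MvPolynomial.algHom_ext (f := F _) (g := x) fun i ↦ by
      change F _ _ = _
      simp [hF]
      rfl
  rw [← hx]
  refine hc.continuousAt.tendsto.frequently (p := fun p ↦ p e ≠ 0) fun H ↦ he ?_
  simp only [ne_eq, not_not, hF] at H
  obtain ⟨ε, hε, h⟩ := Metric.eventually_nhds_iff.mp H
  refine MvPolynomial.funext_set (fun i ↦ Metric.ball (x (MvPolynomial.X i)) ε) (fun i ↦ ?_) ?_
  · exact infinite_of_mem_nhds _ (Metric.ball_mem_nhds _ hε)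
  · intro v hv
    rw [map_zero]
    exact h ((dist_pi_lt_iff hε).mpr fun i ↦ hv i trivial)

/-- A nonempty Zariski open subset of an irreducible affine variety is dense in the classical
topology. -/
lemma frequently_ne_zero [IsDomain C] [Algebra.FiniteType ℂ C] {d : C} (hd : d ≠ 0)
    (t : AffinePoints C) : ∃ᶠ z in 𝓝 t, z d ≠ 0 := by
  obtain ⟨n, g, hg, hfin⟩ := exists_finite_inj_algHom_of_fg ℂ C
  let := g.toRingHom.toAlgebra
  have : IsScalarTower ℂ (MvPolynomial (Fin n) ℂ) C :=
    IsScalarTower.of_algebraMap_eq fun r ↦ (g.commutes r).symm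
  have : Module.Finite (MvPolynomial (Fin n) ℂ) C := hfin
  have : FaithfulSMul (MvPolynomial (Fin n) ℂ) C := (faithfulSMul_iff_algebraMap_injective _ _).mpr hg
  have : Module.IsTorsionFree (MvPolynomial (Fin n) ℂ) C := inferInstance
  -- By integrality the ideal `(d)` meets the polynomial ring of the Noether normalization in some
  -- `e ≠ 0`. As `d` divides `e`, it suffices to find nearby points with `e` non-zero.
  obtain ⟨e, he, he0⟩ := Submodule.exists_mem_ne_zero_of_ne_bot
    (Ideal.comap_ne_bot_of_integral_mem (R := MvPolynomial (Fin n) ℂ) hd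
      (Ideal.mem_span_singleton_self d) (Algebra.IsIntegral.isIntegral d))
  obtain ⟨c, hc⟩ := Ideal.mem_span_singleton.mp (Ideal.mem_comap.mp he)
  have := (exists_eval_ne_zero he0 (restrict _ t)).filter_mono (nhds_le_map_restrict t)
  refine (Filter.frequently_map.mp this).mono fun z hz h ↦ hz ?_
  rw [restrict_apply, hc, map_mul, h, zero_mul]

end AffinePoints

/-! ### Zariski closure versus classical closure of constructible sets -/

/-- The kernel of a homomorphism to a field, as a point of the prime spectrum. -/
def kerPoint {R L : Type*} [CommRing R] [Field L] (x : R →+* L) : PrimeSpectrum R :=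
  ⟨RingHom.ker x, RingHom.ker_isPrime x⟩

@[simp]
lemma kerPoint_asIdeal {R L : Type*} [CommRing R] [Field L] (x : R →+* L) :
    (kerPoint x).asIdeal = RingHom.ker x := rfl

/-- A point in the closure of a constructible set is a specialization of a point of that set. -/
lemma exists_le_of_mem_closure_of_isConstructible {R : Type*} [CommRing R]
    {G : Set (PrimeSpectrum R)} (hG : IsConstructible G) {t : PrimeSpectrum R}
    (ht : t ∈ closure G) : ∃ q ∈ G, q.asIdeal ≤ t.asIdeal := by
  -- A constructible set is the image of some `Spec S`. Its closure is the zero locus of the kernel,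
  -- and the minimal primes over the kernel belong to the image.
  obtain ⟨S, _, f, rfl⟩ := PrimeSpectrum.exists_range_eq_of_isConstructible hG
  rw [PrimeSpectrum.closure_range_comap, PrimeSpectrum.mem_zeroLocus] at ht
  obtain ⟨p, hp, hpt⟩ := Ideal.exists_minimalPrimes_le (J := t.asIdeal) ht
  obtain ⟨q, hq, -, rfl⟩ := Ideal.exists_comap_eq_of_mem_minimalPrimes (I := ⊥) f p hp
  exact ⟨_, ⟨⟨q, hq⟩, rfl⟩, hpt⟩

namespace AffinePoints

variable {C : Type*} [CommRing C] [Algebra ℂ C]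

lemma continuous_kerPoint : Continuous fun x : AffinePoints C ↦ kerPoint (x : C →+* ℂ) := by
  refine PrimeSpectrum.isTopologicalBasis_basic_opens.continuous_iff.mpr ?_
  rintro _ ⟨c, rfl⟩
  exact isOpen_ne.preimage (continuous_eval c)

/-- The Zariski closure and the classical closure of a constructible set agree. -/
lemma frequently_mem_iff [Algebra.FiniteType ℂ C] {G : Set (PrimeSpectrum C)}
    (hG : IsConstructible G) (t : AffinePoints C) :
    (∃ᶠ z : AffinePoints C in 𝓝 t, kerPoint (z : C →+* ℂ) ∈ G) ↔
      kerPoint (t : C →+* ℂ) ∈ closure G := by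
  refine ⟨fun h ↦ mem_closure_of_frequently_of_tendsto h
    continuous_kerPoint.continuousAt.tendsto, fun ht ↦ ?_⟩
  obtain ⟨q, hq, hqt⟩ := exists_le_of_mem_closure_of_isConstructible hG ht
  obtain ⟨S, rfl⟩ := PrimeSpectrum.exists_constructibleSetData_iff.mpr hG
  simp only [PrimeSpectrum.ConstructibleSetData.toSet, Set.mem_iUnion] at hq
  obtain ⟨D, hD, hq⟩ := hq
  -- The locally closed piece of `G` through `q` contains the non-empty open set `D.f ≠ 0` of the
  -- irreducible variety `V(q)`, on which `t` lies.
  have hd : Ideal.Quotient.mk q.asIdeal D.f ≠ 0 := fun h ↦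
    hq.2 (by simpa using Ideal.Quotient.eq_zero_iff_mem.mp h)
  let t' : AffinePoints (C ⧸ q.asIdeal) := Ideal.Quotient.liftₐ q.asIdeal (t : C →ₐ[ℂ] ℂ) hqt
  have ht' : comap (Ideal.Quotient.mkₐ ℂ q.asIdeal) t' = t := rfl
  rw [← ht']
  refine (continuous_comap _).continuousAt.tendsto.frequently
    ((frequently_ne_zero hd t').mono fun z hz ↦ ?_)
  simp only [PrimeSpectrum.ConstructibleSetData.toSet, Set.mem_iUnion]
  refine ⟨D, hD, ?_, fun h ↦ hz ?_⟩
  · intro c hc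
    have : Ideal.Quotient.mk q.asIdeal c = 0 := Ideal.Quotient.eq_zero_iff_mem.mpr (hq.1 hc)
    change z (Ideal.Quotient.mk q.asIdeal c) = 0
    rw [this, map_zero]
  · exact h rfl

end AffinePoints

/-! ### Local injectivity as an algebraic condition -/

/-- The complement of the diagonal in `Spec (B ⊗[A] B)`. -/
def offDiagonal (A B : Type*) [CommRing A] [CommRing B] [Algebra A B] :
    Set (PrimeSpectrum (B ⊗[A] B)) :=
  (PrimeSpectrum.zeroLocus (RingHom.ker (Algebra.TensorProduct.lmul' A (S := B)) : Set (B ⊗[A] B)))ᶜ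

/-- The algebraic counterpart of local injectivity: a point of the diagonal does not lie in the
Zariski closure of the complement of the diagonal. -/
def IsUnramifiedSetTheoretically (A : Type*) {B : Type*} [CommRing A] [CommRing B] [Algebra A B]
    (y : B →+* ℂ) : Prop :=
  kerPoint (y.comp (Algebra.TensorProduct.lmul' A (S := B) : B ⊗[A] B →+* B)) ∉
    closure (offDiagonal A B)

namespace AffinePoints

variable {A B C : Type*} [CommRing A] [CommRing B] [CommRing C]
  [Algebra ℂ A] [Algebra ℂ B] [Algebra ℂ C] [Algebra A B] [IsScalarTower ℂ A B]
  [Algebra A C] [IsScalarTower ℂ A C]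

instance : IsScalarTower ℂ A (B ⊗[A] C) :=
  IsScalarTower.of_algebraMap_eq fun r ↦ by
    rw [Algebra.TensorProduct.algebraMap_apply, Algebra.TensorProduct.algebraMap_apply,
      ← IsScalarTower.algebraMap_apply]

/-- A pair of points with the same image, as a point of the fibre product. -/
def pair (x : AffinePoints B) (y : AffinePoints C) (h : restrict A x = restrict A y) :
    AffinePoints (B ⊗[A] C) :=
  let := (restrict A x : A →+* ℂ).toAlgebra
  ofRingHom x (Algebra.TensorProduct.productMap (R := A) (S := ℂ)
    (AlgHom.mk (x : B →+* ℂ) fun _ ↦ rfl)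
    (AlgHom.mk (y : C →+* ℂ) fun a ↦ congr($h.symm a)) : B ⊗[A] C →+* ℂ) <| by
      ext b
      simp [Algebra.TensorProduct.algebraMap_apply]
      rfl

@[simp]
lemma pair_tmul (x : AffinePoints B) (y : AffinePoints C) (h : restrict A x = restrict A y)
    (b : B) (c : C) : pair x y h (b ⊗ₜ c) = x b * y c := by
  let := (restrict A x : A →+* ℂ).toAlgebra
  exact Algebra.TensorProduct.productMap_apply_tmul (R := A) (S := ℂ)
    (AlgHom.mk (x : B →+* ℂ) fun _ ↦ rfl)
    (AlgHom.mk (y : C →+* ℂ) fun a ↦ congr($h.symm a)) b c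

@[simp]
lemma restrict_pair (x : AffinePoints B) (y : AffinePoints C) (h : restrict A x = restrict A y) :
    restrict B (pair x y h) = x := by
  ext b
  rw [restrict_apply, Algebra.TensorProduct.algebraMap_apply, pair_tmul]
  simp

variable (A B C) in
/-- The second projection from a fibre product, on rings. -/
def includeRight : C →ₐ[ℂ] B ⊗[A] C :=
  AlgHom.restrictScalars ℂ (Algebra.TensorProduct.includeRight : C →ₐ[A] B ⊗[A] C)

lemma includeRight_apply (c : C) : includeRight A B C c = 1 ⊗ₜ c := rfl

@[simp]
lemma comap_includeRight_pair (x : AffinePoints B) (y : AffinePoints C)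
    (h : restrict A x = restrict A y) : comap (includeRight A B C) (pair x y h) = y := by
  ext c
  rw [comap_apply, includeRight_apply, pair_tmul, map_one, one_mul]

lemma apply_tmul (w : AffinePoints (B ⊗[A] C)) (b : B) (c : C) :
    w (b ⊗ₜ c) = restrict B w b * comap (includeRight A B C) w c := by
  rw [restrict_apply, comap_apply, ← map_mul, Algebra.TensorProduct.algebraMap_apply,
    includeRight_apply, Algebra.TensorProduct.tmul_mul_tmul]
  simp

lemma restrict_restrict_eq (w : AffinePoints (B ⊗[A] C)) :
    restrict A (restrict B w) = restrict A (comap (includeRight A B C) w) := by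
  ext a
  simp only [restrict_apply, comap_apply, includeRight_apply]
  rw [Algebra.TensorProduct.algebraMap_apply, Algebra.algebraMap_self, RingHom.id_apply,
    Algebra.algebraMap_eq_smul_one, Algebra.algebraMap_eq_smul_one, TensorProduct.smul_tmul]

variable (A B) in
/-- The diagonal, on rings. -/
def lmul : B ⊗[A] B →ₐ[ℂ] B :=
  AlgHom.restrictScalars ℂ (Algebra.TensorProduct.lmul' A (S := B) : B ⊗[A] B →ₐ[A] B)

lemma lmul_tmul (b b' : B) : lmul A B (b ⊗ₜ b') = b * b' := by simp [lmul]

lemma kerPoint_mem_offDiagonal_iff (w : AffinePoints (B ⊗[A] B)) :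
    kerPoint (w : B ⊗[A] B →+* ℂ) ∈ offDiagonal A B ↔
      restrict B w ≠ comap (includeRight A B B) w := by
  rw [offDiagonal, Set.mem_compl_iff, PrimeSpectrum.mem_zeroLocus, not_iff_not]
  refine ⟨fun h ↦ ?_, fun h ↦ ?_⟩
  · ext b
    have : b ⊗ₜ 1 - 1 ⊗ₜ b ∈ RingHom.ker (Algebra.TensorProduct.lmul' A (S := B)) := by
      simp [RingHom.mem_ker]
    have := h this
    simpa [RingHom.mem_ker, sub_eq_zero, includeRight_apply] using this
  · have : w = comap (lmul A B) (restrict B w) := by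
      ext c
      induction c with
      | zero => simp
      | tmul b b' => rw [comap_apply (lmul A B), lmul_tmul, map_mul, apply_tmul, h]
      | add c c' h h' => rw [map_add, map_add, h, h']
    intro c hc
    have hc : lmul A B c = 0 := hc
    change w c = 0
    rw [this, comap_apply, hc, map_zero]

lemma kerPoint_pair_mem_offDiagonal_iff (x y : AffinePoints B) (h : restrict A x = restrict A y) :
    kerPoint (pair x y h : B ⊗[A] B →+* ℂ) ∈ offDiagonal A B ↔ x ≠ y := by
  rw [kerPoint_mem_offDiagonal_iff, restrict_pair, comap_includeRight_pair]

lemma continuous_pair : Continuous fun p : {p : AffinePoints B × AffinePoints C //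
    restrict A p.1 = restrict A p.2} ↦ pair p.1.1 p.1.2 p.2 := by
  refine continuous_iff.mpr fun c ↦ ?_
  induction c with
  | zero => simpa using continuous_const
  | tmul b c =>
    simp only [pair_tmul]
    exact ((continuous_eval b).comp (continuous_fst.comp continuous_subtype_val)).mul
      ((continuous_eval c).comp (continuous_snd.comp continuous_subtype_val))
  | add c c' h h' => 
    simp only [map_add]
    exact h.add h'

/-- Local injectivity fails at `y` exactly when pairs of distinct points with equal image accumulate
at `(y, y)`. Complex points of `B ⊗[A] B` are such pairs, so this is classical adherence to the
constructible off-diagonal, which `frequently_mem_iff` turns into Zariski adherence. -/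
lemma isUnramifiedSetTheoretically_iff [Algebra.FiniteType ℂ A] [Module.Finite A B]
    (y : AffinePoints B) :
    IsUnramifiedSetTheoretically A (y : B →+* ℂ) ↔
      ∃ N ∈ 𝓝 y, Set.InjOn (restrict A) N := by
  have : Algebra.FiniteType ℂ B := Algebra.FiniteType.trans (S := A) inferInstance inferInstance
  have : Algebra.FiniteType ℂ (B ⊗[A] B) :=
    Algebra.FiniteType.trans (S := B) inferInstance inferInstance
  have : IsNoetherianRing (B ⊗[A] B) := Algebra.FiniteType.isNoetherianRing ℂ _
  have hG : IsConstructible (offDiagonal A B) :=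
    (PrimeSpectrum.isRetrocompact_zeroLocus_compl_of_fg (IsNoetherian.noetherian _)).isConstructible
      (PrimeSpectrum.isClosed_zeroLocus _).isOpen_compl
  have key := frequently_mem_iff hG (comap (lmul A B) y)
  rw [IsUnramifiedSetTheoretically, ← not_iff_not, not_not]
  refine Iff.trans key.symm ⟨fun h ↦ ?_, fun h ↦ ?_⟩
  · rintro ⟨N, hN, hinj⟩
    have h1 : Tendsto (restrict B) (𝓝 (comap (lmul A B) y)) (𝓝 y) := by
      have : restrict B (comap (lmul A B) y) = y := by ext b; simp [lmul_tmul]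
      exact continuous_restrict.tendsto' _ _ this
    have h2 : Tendsto (comap (includeRight A B B)) (𝓝 (comap (lmul A B) y)) (𝓝 y) := by
      have : comap (includeRight A B B) (comap (lmul A B) y) = y := by
        ext b; simp [includeRight_apply, lmul_tmul]
      exact (continuous_comap _).tendsto' _ _ this
    obtain ⟨w, hw, hw1, hw2⟩ := (h.and_eventually (Filter.inter_mem (h1 hN) (h2 hN))).exists
    rw [kerPoint_mem_offDiagonal_iff] at hw
    exact hw (hinj hw1 hw2 (restrict_restrict_eq w))
  · let P := {p : AffinePoints B × AffinePoints B // restrict A p.1 = restrict A p.2}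
    have hf : ∃ᶠ p : P in 𝓝 (⟨(y, y), rfl⟩ : P), p.1.1 ≠ p.1.2 := by
      intro H
      refine h ?_
      simp only [not_not] at H
      rw [nhds_subtype_eq_comap, Filter.eventually_comap, nhds_prod_eq] at H
      obtain ⟨N, hN, H⟩ := Filter.mem_prod_self_iff.mp H
      exact ⟨N, hN, fun z hz z' hz' hzz ↦ H (Set.mk_mem_prod hz hz') ⟨(z, z'), hzz⟩ rfl⟩
    have hyy : pair (A := A) y y rfl = comap (lmul A B) y := by
      ext c
      induction c with
      | zero => simp
      | tmul b b' => rw [pair_tmul, comap_apply, lmul_tmul, map_mul]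
      | add c c' h h' => rw [map_add, map_add, h, h']
    rw [← hyy]
    have hc : Tendsto (fun p : P ↦ pair p.1.1 p.1.2 p.2) (𝓝 (⟨(y, y), rfl⟩ : P))
        (𝓝 (pair (A := A) y y rfl)) := continuous_pair.tendsto _
    exact hc.frequently (hf.mono fun p hp ↦
      (kerPoint_pair_mem_offDiagonal_iff p.1.1 p.1.2 p.2).mpr hp)

end AffinePoints

/-! ### Openness as an algebraic condition -/

/-- The element `∏ⱼ (b - Xⱼ)` of `A[X₁, …, Xₙ] ⊗ B`. -/
def prodSub (A : Type*) {B : Type*} [CommRing A] [CommRing B] [Algebra A B] (b : B) (n : ℕ) :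
    MvPolynomial (Fin n) A ⊗[A] B :=
  ∏ j, (1 ⊗ₜ b - MvPolynomial.X j ⊗ₜ 1)

/-- The locus of those `(x, v₁, …, vₙ)` such that every value of `b` on the fibre over `x` is one of
the `vⱼ`. -/
def valuesLocus (A : Type*) {B : Type*} [CommRing A] [CommRing B] [Algebra A B] (b : B) (n : ℕ) :
    Set (PrimeSpectrum (MvPolynomial (Fin n) A)) :=
  (PrimeSpectrum.comap (algebraMap (MvPolynomial (Fin n) A) (MvPolynomial (Fin n) A ⊗[A] B)) ''
    PrimeSpectrum.basicOpen (prodSub A b n))ᶜ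

/-- The algebraic counterpart of openness at a point: it is impossible for the values of `b` near
the image of `y` to stay away from the value of `b` at `y`. -/
def IsOpenSetTheoretically (A : Type*) {B : Type*} [CommRing A] [CommRing B] [Algebra A B]
    (y : B →+* ℂ) : Prop :=
  ∀ (b : B) (n : ℕ) (t : MvPolynomial (Fin n) A →+* ℂ),
    t.comp MvPolynomial.C = y.comp (algebraMap A B) → (∀ j, t (MvPolynomial.X j) ≠ y b) →
      kerPoint t ∉ closure (valuesLocus A b n)

/-- A finite set with at most `n` elements lies in the range of a family indexed by `Fin (n + 1)`
whose other members are equal to a given element. -/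
lemma exists_fin_enumeration {α : Type*} (c : α) (n : ℕ) (s : Finset α) (hs : s.card ≤ n) :
    ∃ v : Fin (n + 1) → α, (∀ a ∈ s, ∃ j, v j = a) ∧ ∀ j, v j ∈ s ∨ v j = c := by
  classical
  -- The extra slot makes room for `c`, which keeps the set non-empty when `s` is empty.
  obtain ⟨e⟩ : Nonempty ((insert c s : Finset α) ↪ Fin (n + 1)) :=
    Function.Embedding.nonempty_of_card_le (by
      simpa using (Finset.card_insert_le c s).trans (Nat.add_le_add_right hs 1))
  have : Nonempty (insert c s : Finset α) := ⟨⟨c, Finset.mem_insert_self c s⟩⟩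
  refine ⟨fun j ↦ (Function.invFun e j : (insert c s : Finset α)), fun a ha ↦ ?_, fun j ↦ ?_⟩
  · obtain ⟨j, hj⟩ := Function.invFun_surjective e.injective ⟨a, Finset.mem_insert_of_mem ha⟩
    exact ⟨j, congr_arg Subtype.val hj⟩
  · exact (Finset.mem_insert.mp (Function.invFun e j : (insert c s : Finset α)).2).symm

namespace AffinePoints

variable {A B : Type*} [CommRing A] [CommRing B]
  [Algebra ℂ A] [Algebra ℂ B] [Algebra A B] [IsScalarTower ℂ A B]

omit [Algebra ℂ B] [IsScalarTower ℂ A B] in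
lemma isConstructible_valuesLocus [Algebra.FiniteType ℂ A] [Module.Finite A B] (b : B) (n : ℕ) :
    IsConstructible (valuesLocus A b n) := by
  have : IsNoetherianRing A := Algebra.FiniteType.isNoetherianRing ℂ _
  have hfp : Algebra.FinitePresentation (MvPolynomial (Fin n) A) (MvPolynomial (Fin n) A ⊗[A] B) :=
    Algebra.FinitePresentation.of_finiteType.mp inferInstance
  exact (PrimeSpectrum.isConstructible_comap_image
    (RingHom.finitePresentation_algebraMap.mpr hfp) PrimeSpectrum.isConstructible_basicOpen).compl

lemma apply_prodSub {n : ℕ} (b : B) (w : AffinePoints (MvPolynomial (Fin n) A ⊗[A] B)) :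
    w (prodSub A b n) = ∏ j, (comap (includeRight A (MvPolynomial (Fin n) A) B) w b -
      restrict (MvPolynomial (Fin n) A) w (MvPolynomial.X j)) := by
  rw [prodSub, map_prod]
  refine Finset.prod_congr rfl fun j _ ↦ ?_
  rw [map_sub, apply_tmul, apply_tmul]
  simp only [map_one, one_mul, mul_one]

/-- By integrality, every prime over the kernel of `t` is the kernel of a complex point, so the
scheme-theoretic image in the definition can be tested on pairs `(t, z)`. -/
lemma kerPoint_mem_valuesLocus_iff [Module.Finite A B] {n : ℕ} (b : B)
    (t : AffinePoints (MvPolynomial (Fin n) A)) :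
    kerPoint (t : MvPolynomial (Fin n) A →+* ℂ) ∈ valuesLocus A b n ↔
      ∀ z : AffinePoints B, restrict A z = restrict A t → ∃ j, z b = t (MvPolynomial.X j) := by
  refine ⟨fun h z hz ↦ ?_, fun h ⟨q, hq, hqt⟩ ↦ ?_⟩
  · by_contra! H
    let w := pair t z hz.symm
    refine h ⟨kerPoint (w : _ →+* ℂ), fun hw ↦ ?_, ?_⟩
    · have hw : w (prodSub A b n) = 0 := hw
      rw [apply_prodSub, Finset.prod_eq_zero_iff] at hw
      obtain ⟨j, -, hj⟩ := hw
      rw [restrict_pair, comap_includeRight_pair, sub_eq_zero] at hj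
      exact H j hj
    · have : restrict (MvPolynomial (Fin n) A) w = t := restrict_pair t z hz.symm
      conv_rhs => rw [← this]
      rfl
  · obtain ⟨w, hw, hwq⟩ := exists_restrict_eq t q.asIdeal (congr_arg PrimeSpectrum.asIdeal hqt)
    obtain ⟨j, hj⟩ := h (comap (includeRight A (MvPolynomial (Fin n) A) B) w) (by
      rw [← restrict_restrict_eq, hw])
    refine hq ?_
    rw [← hwq, RingHom.mem_ker]
    change w (prodSub A b n) = 0
    rw [apply_prodSub, hw]
    exact Finset.prod_eq_zero (Finset.mem_univ j) (sub_eq_zero.mpr hj)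

/-- The point of `X × 𝔸ⁿ` with the given coordinates. -/
def withCoords {n : ℕ} (x : AffinePoints A) (v : Fin n → ℂ) :
    AffinePoints (MvPolynomial (Fin n) A) :=
  ofRingHom x (MvPolynomial.eval₂Hom (x : A →+* ℂ) v) (by ext; simp)

@[simp]
lemma restrict_withCoords {n : ℕ} (x : AffinePoints A) (v : Fin n → ℂ) :
    restrict A (withCoords x v) = x := restrict_ofRingHom _ _ _

@[simp]
lemma withCoords_X {n : ℕ} (x : AffinePoints A) (v : Fin n → ℂ) (j : Fin n) :
    withCoords x v (MvPolynomial.X j) = v j := by simp [withCoords]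

lemma tendsto_withCoords {T : Type*} {l : Filter T} {n : ℕ} {f : T → AffinePoints A}
    {v : T → Fin n → ℂ} {x : AffinePoints A} {u : Fin n → ℂ} (hf : Tendsto f l (𝓝 x))
    (hv : Tendsto v l (𝓝 u)) : Tendsto (fun t ↦ withCoords (f t) (v t)) l (𝓝 (withCoords x u)) := by
  refine tendsto_nhds_iff.mpr fun g ↦ ?_
  induction g using MvPolynomial.induction_on with
  | C a =>
    have (x : AffinePoints A) (v : Fin n → ℂ) : withCoords x v (MvPolynomial.C a) = x a := by
      simp [withCoords]
    simp only [this]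
    exact tendsto_nhds_iff.mp hf a
  | add g h hg hh =>
    simp only [map_add]
    exact hg.add hh
  | mul_X g j hg =>
    simp only [map_mul, withCoords_X]
    exact hg.mul (tendsto_pi_nhds.mp hv j)

/-- If `t` were in the Zariski closure, some `w` of the locus would be classically close to `t`. By
openness the base point of `w` has a preimage `z` near `y`; then `z b` is a coordinate of `w`,
although it is near `y b` and the coordinates of `t` differ from `y b`. -/
lemma isOpenSetTheoretically_of_nhds_le [Algebra.FiniteType ℂ A] [Module.Finite A B]
    (y : AffinePoints B) (hy : 𝓝 (restrict A y) ≤ Filter.map (restrict A) (𝓝 y)) :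
    IsOpenSetTheoretically A (y : B →+* ℂ) := by
  intro b n t₀ ht₀ hX ht
  obtain ⟨t, rfl⟩ : ∃ t : AffinePoints (MvPolynomial (Fin n) A), (t : _ →+* ℂ) = t₀ :=
    ⟨ofRingHom (restrict A y) t₀ ht₀, rfl⟩
  have htx : restrict A t = restrict A y := ext fun a ↦ congr($ht₀ a)
  have : Algebra.FiniteType ℂ (MvPolynomial (Fin n) A) :=
    Algebra.FiniteType.trans (S := A) inferInstance inferInstance
  have hf := (frequently_mem_iff (isConstructible_valuesLocus (A := A) b n) t).mpr ht
  have hne : ∀ᶠ p : AffinePoints (MvPolynomial (Fin n) A) × AffinePoints B in 𝓝 t ×ˢ 𝓝 y,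
      ∀ j, p.2 b ≠ p.1 (MvPolynomial.X j) := by
    rw [← nhds_prod_eq, Filter.eventually_all]
    intro j
    exact (isOpen_ne_fun ((continuous_eval b).comp continuous_snd)
      ((continuous_eval (MvPolynomial.X j)).comp continuous_fst)).mem_nhds (hX j).symm
  obtain ⟨W, hW, N, hN, hWN⟩ := Filter.eventually_prod_iff.mp hne
  have hres : ∀ᶠ w in 𝓝 t, restrict A w ∈ restrict A '' {z | N z} := by
    have h1 : restrict A '' {z | N z} ∈ 𝓝 (restrict A t) :=
      htx ▸ hy (Filter.image_mem_map hN)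
    exact (continuous_restrict (A := A) (B := MvPolynomial (Fin n) A)).continuousAt.tendsto h1
  obtain ⟨w, hw, hwW, z, hz, hzw⟩ := (hf.and_eventually (hW.and hres)).exists
  obtain ⟨j, hj⟩ := (kerPoint_mem_valuesLocus_iff b w).mp hw z hzw
  exact hWN hwW hz j hj

lemma card_eval_fiber_le (x : AffinePoints A) (b : B) {P : Polynomial A} (hP : P.Monic)
    (hb : Polynomial.aeval b P = 0) :
    ∃ s : Finset ℂ, s.card ≤ P.natDegree ∧
      ∀ v, v ∈ s ↔ ∃ z : AffinePoints B, restrict A z = x ∧ z b = v := by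
  classical
  have hroot (z : AffinePoints B) (hz : restrict A z = x) :
      z b ∈ (P.map (x : A →+* ℂ)).roots.toFinset := by
    rw [Multiset.mem_toFinset, Polynomial.mem_roots (hP.map _).ne_zero, Polynomial.IsRoot.def, ← hz,
      ← eval_eq, hb, map_zero]
  refine ⟨(P.map (x : A →+* ℂ)).roots.toFinset.filter
    fun v ↦ ∃ z : AffinePoints B, restrict A z = x ∧ z b = v, ?_, fun v ↦ ?_⟩
  · refine (Finset.card_filter_le _ _).trans ((Multiset.toFinset_card_le _).trans ?_)
    exact (Polynomial.card_roots' _).trans (hP.natDegree_map _).le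
  · rw [Finset.mem_filter]
    exact ⟨fun h ↦ h.2, fun ⟨z, hz, hv⟩ ↦ ⟨hv ▸ hroot z hz, z, hz, hv⟩⟩

/-- If a finite map is not open at `y`, the values of a separating function near the image of `y`
stay away from its value at `y`. -/
lemma exists_values_of_not_nhds_le [Module.Finite A B] (y : AffinePoints B)
    (hy : ¬ 𝓝 (restrict A y) ≤ Filter.map (restrict A) (𝓝 y)) :
    ∃ (b : B) (n : ℕ) (l : Ultrafilter (AffinePoints A)) (v : AffinePoints A → Fin n → ℂ)
      (u : Fin n → ℂ), y b = 0 ∧ (l : Filter (AffinePoints A)) ≤ 𝓝 (restrict A y) ∧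
      (∀ j, u j ≠ 0) ∧ Tendsto v l (𝓝 u) ∧
      ∀ z : AffinePoints B, ∃ j, z b = v (restrict A z) j := by
  rw [Filter.le_def] at hy
  push Not at hy
  obtain ⟨S, hS, hSx⟩ := hy
  obtain ⟨b, hb, hsep⟩ := exists_separating (A := A) y
  obtain ⟨P, hP, hbP⟩ := Algebra.IsIntegral.isIntegral (R := A) b
  rw [Filter.mem_map, nhds_eq y b hb hsep, Filter.mem_inf_iff_superset] at hS
  obtain ⟨S', ⟨M, hM, hMS⟩, T, ⟨D, hD, hDT⟩, hST⟩ := hS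
  obtain ⟨ε, hε, hεD⟩ := Metric.mem_nhds_iff.mp hD
  obtain ⟨K, hK⟩ := exists_norm_eval_le (A := A) (B := B) (x := restrict A y) tendsto_comap b
  rw [Filter.eventually_comap] at hK
  choose s hs hsv using fun x : AffinePoints A ↦ card_eval_fiber_le (B := B) x b hP hbP
  -- The padding value `1` is as good as any non-zero number: it must stay away from `y b = 0`.
  choose v hv hvs using fun x ↦ exists_fin_enumeration (1 : ℂ) P.natDegree (s x) (hs x)
  have hne : (𝓝 (restrict A y) ⊓ 𝓟 Sᶜ).NeBot := by
    rw [Filter.neBot_iff]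
    intro h
    exact hSx (Filter.mem_iff_inf_principal_compl.mpr h)
  let l := Ultrafilter.of (𝓝 (restrict A y) ⊓ 𝓟 Sᶜ)
  have hl : (l : Filter (AffinePoints A)) ≤ 𝓝 (restrict A y) ⊓ 𝓟 Sᶜ := Ultrafilter.of_le _
  have hlx := hl.trans inf_le_left
  have hlS : ∀ᶠ x in (l : Filter (AffinePoints A)), x ∉ S :=
    (hl.trans inf_le_right) (Filter.mem_principal_self _)
  -- Outside `S` no fibre point has `‖b‖ < ε`, so genuine values lie in a compact annulus; the `max`
  -- and `min` with `1` make it contain the padding value.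
  have hbound : ∀ᶠ x in (l : Filter (AffinePoints A)), ∀ j,
      v x j ∈ Metric.closedBall (0 : ℂ) (max K 1) ∩ {u | min ε 1 ≤ ‖u‖} := by
    filter_upwards [hlS, hlx hM, hlx hK] with x hxS hxM hxK j
    rcases hvs x j with h | h
    · obtain ⟨z, hz, hzv⟩ := (hsv x _).mp h
      rw [← hzv]
      refine ⟨by simpa using Or.inl (hxK z hz), ?_⟩
      by_contra H
      have H : ‖z b‖ < min ε 1 := not_le.mp H
      have : restrict A z ∈ S := hST ⟨hMS (by rwa [Set.mem_preimage, hz]),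
        hDT (hεD (by simpa using H.trans_le (min_le_left _ _)))⟩
      exact hxS (hz ▸ this)
    · rw [h]
      simp
  have hcl : IsClosed {u : ℂ | min ε 1 ≤ ‖u‖} := isClosed_le continuous_const continuous_norm
  have hlim (j : Fin (P.natDegree + 1)) : ∃ u : ℂ, u ≠ 0 ∧ Tendsto (fun x ↦ v x j) l (𝓝 u) := by
    obtain ⟨u, hu, hlu⟩ := ((isCompact_closedBall (0 : ℂ) (max K 1)).inter_right
      hcl).ultrafilter_le_nhds (l.map fun x ↦ v x j) (by
        rw [Filter.le_principal_iff]
        exact hbound.mono fun x hx ↦ hx j)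
    refine ⟨u, ?_, hlu⟩
    rintro rfl
    have := hu.2
    exact (lt_min hε one_pos).not_ge (norm_zero (E := ℂ) ▸ this)
  choose u hu0 hu using hlim
  refine ⟨b, _, l, v, u, hb, hlx, hu0, tendsto_pi_nhds.mpr hu, fun z ↦ ?_⟩
  obtain ⟨j, hj⟩ := hv _ _ ((hsv (restrict A z) _).mpr ⟨z, rfl, rfl⟩)
  exact ⟨j, hj.symm⟩

lemma nhds_le_of_isOpenSetTheoretically [Module.Finite A B]
    (y : AffinePoints B) (hy : IsOpenSetTheoretically A (y : B →+* ℂ)) :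
    𝓝 (restrict A y) ≤ Filter.map (restrict A) (𝓝 y) := by
  by_contra h
  obtain ⟨b, n, l, v, u, hb, hl, hu0, hu, hv⟩ := exists_values_of_not_nhds_le y h
  have htend := tendsto_withCoords hl hu
  refine hy b n (withCoords (restrict A y) u : MvPolynomial (Fin n) A →+* ℂ) ?_ (fun j ↦ ?_) ?_
  · ext a
    exact congr($(restrict_withCoords (restrict A y) u) a)
  · change withCoords (restrict A y) u _ ≠ y b
    rw [withCoords_X, hb]
    exact hu0 j
  · refine mem_closure_of_tendsto ((continuous_kerPoint.tendsto _).comp htend)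
      (.of_forall fun x ↦ ?_)
    rw [Function.comp_apply, kerPoint_mem_valuesLocus_iff]
    intro z hz
    obtain ⟨j, hj⟩ := hv z
    rw [restrict_withCoords] at hz
    exact ⟨j, by rw [withCoords_X, hj, hz]⟩

/-- Openness at a point, for the classical topology, is an algebraic property. -/
lemma isOpenSetTheoretically_iff [Algebra.FiniteType ℂ A] [Module.Finite A B]
    (y : AffinePoints B) : IsOpenSetTheoretically A (y : B →+* ℂ) ↔
      𝓝 (restrict A y) ≤ Filter.map (restrict A) (𝓝 y) :=
  ⟨nhds_le_of_isOpenSetTheoretically y, isOpenSetTheoretically_of_nhds_le y⟩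

end AffinePoints

/-! ### Invariance under automorphisms of `ℂ` and the covering criterion -/

lemma kerPoint_ringEquiv_comp {R L L' : Type*} [CommRing R] [Field L] [Field L'] (τ : L ≃+* L')
    (x : R →+* L) : kerPoint ((τ : L →+* L').comp x) = kerPoint x := by
  ext c
  simp [RingHom.mem_ker]

lemma IsUnramifiedSetTheoretically.of_comp {A B : Type*} [CommRing A] [CommRing B] [Algebra A B]
    (τ : ℂ ≃+* ℂ) {y : B →+* ℂ}
    (h : IsUnramifiedSetTheoretically A ((τ : ℂ →+* ℂ).comp y)) :
    IsUnramifiedSetTheoretically A y := by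
  rwa [IsUnramifiedSetTheoretically, RingHom.comp_assoc, kerPoint_ringEquiv_comp] at h

lemma IsOpenSetTheoretically.of_comp {A B : Type*} [CommRing A] [CommRing B] [Algebra A B]
    (τ : ℂ ≃+* ℂ) {y : B →+* ℂ} (h : IsOpenSetTheoretically A ((τ : ℂ →+* ℂ).comp y)) :
    IsOpenSetTheoretically A y := by
  intro b n t ht htX
  rw [← kerPoint_ringEquiv_comp τ t]
  refine h b n ((τ : ℂ →+* ℂ).comp t) ?_ fun j hj ↦ htX j (τ.injective hj)
  rw [RingHom.comp_assoc, ht, RingHom.comp_assoc]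

/-- The algebraic counterpart of being a covering map on complex points. -/
def IsCoverSetTheoretically (A B : Type*) [CommRing A] [CommRing B] [Algebra A B] (s : ℂ →+* A) :
    Prop :=
  ∀ y : B →+* ℂ, (y.comp (algebraMap A B)).comp s = RingHom.id ℂ →
    IsUnramifiedSetTheoretically A y ∧ IsOpenSetTheoretically A y

/-- If `y` is a point for the structure map `s ∘ τ`, then `τ ∘ y` is one for `s`, with the same
kernel. -/
lemma IsCoverSetTheoretically.comp {A B : Type*} [CommRing A] [CommRing B] [Algebra A B]
    {s : ℂ →+* A} (h : IsCoverSetTheoretically A B s) (τ : ℂ ≃+* ℂ) :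
    IsCoverSetTheoretically A B (s.comp (τ : ℂ →+* ℂ)) := by
  intro y hy
  have := h ((τ : ℂ →+* ℂ).comp y) (by
    ext v
    simpa using congr(τ ($hy (τ.symm v))))
  exact ⟨this.1.of_comp τ, this.2.of_comp τ⟩

/-- A continuous map that is open and injective near every point is a local homeomorphism. -/
lemma isLocalHomeomorph_of_nhds_le {X Y : Type*} [TopologicalSpace X] [TopologicalSpace Y]
    {f : X → Y} (hf : Continuous f) (ho : ∀ x, 𝓝 (f x) ≤ Filter.map f (𝓝 x))
    (hi : ∀ x, ∃ N ∈ 𝓝 x, Set.InjOn f N) : IsLocalHomeomorph f := by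
  rw [isLocalHomeomorph_iff_isOpenEmbedding_restrict]
  intro x
  obtain ⟨N, hN, hinj⟩ := hi x
  obtain ⟨U, hUN, hU, hxU⟩ := mem_nhds_iff.mp hN
  refine ⟨U, hU.mem_nhds hxU, .of_continuous_injective_isOpenMap ?_ ?_ ?_⟩
  · exact hf.comp continuous_subtype_val
  · exact Set.injOn_iff_injective.mp (hinj.mono hUN)
  · exact (IsOpenMap.of_nhds_le ho).comp hU.isOpenMap_subtype_val

namespace AffinePoints

variable {A B : Type*} [CommRing A] [CommRing B]
  [Algebra ℂ A] [Algebra ℂ B] [Algebra A B] [IsScalarTower ℂ A B]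

/-- The two algebraic conditions say that the map is a local homeomorphism; being closed with finite
fibres, it is then a covering map. -/
lemma isCoveringMap_restrict_iff [Algebra.FiniteType ℂ A] [Module.Finite A B] :
    IsCoveringMap (restrict A : AffinePoints B → AffinePoints A) ↔
      IsCoverSetTheoretically A B (algebraMap ℂ A) := by
  refine ⟨fun h y hy ↦ ?_, fun h ↦ ?_⟩
  · obtain ⟨y, rfl⟩ : ∃ z : AffinePoints B, (z : B →+* ℂ) = y := by
      refine ⟨(AlgHom.mk y fun v ↦ ?_ : B →ₐ[ℂ] ℂ), rfl⟩
      have := congr($hy v)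
      rwa [RingHom.comp_apply, RingHom.comp_apply, ← IsScalarTower.algebraMap_apply] at this
    rw [isUnramifiedSetTheoretically_iff, isOpenSetTheoretically_iff]
    have hl := h.isLocalHomeomorph
    obtain ⟨U, hU, hy⟩ := isLocalHomeomorph_iff_isOpenEmbedding_restrict.mp hl y
    exact ⟨⟨U, hU, Set.injOn_iff_injective.mpr hy.injective⟩, (hl.map_nhds_eq y).ge⟩
  · have hy (y : AffinePoints B) := h (y : B →+* ℂ) (by
      ext v
      have := AlgHomClass.commutes y v
      rwa [IsScalarTower.algebraMap_apply ℂ A B] at this)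
    have hl : IsLocalHomeomorph (restrict A : AffinePoints B → AffinePoints A) :=
      isLocalHomeomorph_of_nhds_le continuous_restrict
        (fun y ↦ (isOpenSetTheoretically_iff y).mp (hy y).2)
        (fun y ↦ (isUnramifiedSetTheoretically_iff y).mp (hy y).1)
    exact isCoveringMap_iff_isCoveringMapOn_univ.mpr
      (isClosedMap_restrict.isCoveringMapOn_of_isLocalHomeomorphOn (fun x _ ↦ finite_fiber x)
        hl.isLocalHomeomorphOn)

end AffinePoints

/-! ### Evaluation of sections and affine charts of the space of complex points -/

/-- The value at a complex point of a section over a neighbourhood of that point. -/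
def evalOn {X : Scheme.{0}} (p : Spec (.of ℂ) ⟶ X) (U : X.Opens) (h : ⊤ ≤ p ⁻¹ᵁ U) :
    Γ(X, U) →+* ℂ :=
  (p.appLE U ⊤ h ≫ (Scheme.ΓSpecIso (.of ℂ)).hom).hom

lemma evalOn_map {X : Scheme.{0}} (p : Spec (.of ℂ) ⟶ X) {U V : X.Opens} (h : ⊤ ≤ p ⁻¹ᵁ U)
    (hUV : U ≤ V) (f : Γ(X, V)) :
    evalOn p U h (X.presheaf.map (homOfLE hUV).op f) =
      evalOn p V (h.trans (p.preimage_mono hUV)) f := by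
  simp only [evalOn]
  rw [← CommRingCat.comp_apply, ← Category.assoc, Scheme.Hom.map_appLE]

lemma evalOn_comp {X Y : Scheme.{0}} (p : Spec (.of ℂ) ⟶ X) (g : X ⟶ Y) (U : Y.Opens)
    (h : ⊤ ≤ (p ≫ g) ⁻¹ᵁ U) (V : X.Opens) (hV : ⊤ ≤ p ⁻¹ᵁ V) (hUV : V ≤ g ⁻¹ᵁ U) :
    evalOn (p ≫ g) U h = (evalOn p V hV).comp (g.appLE U V hUV).hom := by
  rw [evalOn, ← Scheme.Hom.appLE_comp_appLE p g U V ⊤ hUV hV, Category.assoc, CommRingCat.hom_comp]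
  rfl

lemma top_le_preimage_iff {X : Scheme.{0}} (p : Spec (.of ℂ) ⟶ X) (U : X.Opens) :
    ⊤ ≤ p ⁻¹ᵁ U ↔ p (IsLocalRing.closedPoint ℂ) ∈ U := by
  refine ⟨fun h ↦ h (Set.mem_univ _), fun h x _ ↦ ?_⟩
  rwa [Subsingleton.elim (α := PrimeSpectrum ℂ) x (IsLocalRing.closedPoint ℂ)]

lemma exists_lift_iff {X : Scheme.{0}} (p : Spec (.of ℂ) ⟶ X) (U : X.Opens) :
    (∃ y : Spec (.of ℂ) ⟶ U, y ≫ U.ι = p) ↔ ⊤ ≤ p ⁻¹ᵁ U := by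
  refine ⟨?_, fun h ↦ ⟨IsOpenImmersion.lift U.ι p ?_, IsOpenImmersion.lift_fac _ _ _⟩⟩
  · rintro ⟨y, rfl⟩ x -
    exact (y x).2
  · rintro _ ⟨x, rfl⟩
    rw [Scheme.Opens.range_ι]
    exact h (Set.mem_univ x)

lemma evalAt_eq {X : Scheme.{0}} (U : X.Opens) (y : Spec (.of ℂ) ⟶ U) (f : Γ(U, ⊤))
    (h : ⊤ ≤ (y ≫ U.ι) ⁻¹ᵁ U) : evalAt y f = evalOn (y ≫ U.ι) U h (U.topIso.hom f) := by
  have key : U.topIso.hom ≫ U.ι.appLE U ⊤ U.ι_preimage_self.ge = 𝟙 _ := by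
    rw [Scheme.Opens.ι_appLE, Scheme.Opens.topIso_hom]
    exact (X.presheaf.map_comp _ _).symm.trans (X.presheaf.map_id _)
  have : evalOn y ⊤ le_top = (y.appTop ≫ (Scheme.ΓSpecIso (.of ℂ)).hom).hom := by
    have : y.appLE ⊤ ⊤ le_top = y.appTop := y.appLE_eq_app
    exact congr(($this ≫ (Scheme.ΓSpecIso (.of ℂ)).hom).hom)
  rw [evalOn_comp y U.ι U h ⊤ le_top U.ι_preimage_self.ge, this]
  have hf := congr($(key).hom f)
  simp only [CommRingCat.hom_comp, RingHom.comp_apply, CommRingCat.hom_id, RingHom.id_apply] at hf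
  conv_lhs => rw [← hf]
  rfl

lemma top_le_preimage_specMap {X : Scheme.{0}} {U : X.Opens} (hU : IsAffineOpen U)
    (x : Γ(X, U) →+* ℂ) : ⊤ ≤ (Spec.map (CommRingCat.ofHom x) ≫ hU.fromSpec) ⁻¹ᵁ U := by
  intro t _
  have : hU.fromSpec (Spec.map (CommRingCat.ofHom x) t) ∈ Set.range hU.fromSpec := ⟨_, rfl⟩
  rwa [hU.range_fromSpec] at this

lemma specMap_evalOn {X : Scheme.{0}} {U : X.Opens} (hU : IsAffineOpen U) (p : Spec (.of ℂ) ⟶ X)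
    (h : ⊤ ≤ p ⁻¹ᵁ U) : Spec.map (CommRingCat.ofHom (evalOn p U h)) ≫ hU.fromSpec = p := by
  have : CommRingCat.ofHom (evalOn p U h) = p.appLE U ⊤ h ≫ (Scheme.ΓSpecIso (.of ℂ)).hom := rfl
  rw [this, Spec.map_comp, Category.assoc,
    IsAffineOpen.SpecMap_appLE_fromSpec p hU (isAffineOpen_top _) h, IsAffineOpen.fromSpec_top]
  simp [Scheme.isoSpec_Spec]

lemma evalOn_specMap {X : Scheme.{0}} {U : X.Opens} (hU : IsAffineOpen U) (x : Γ(X, U) →+* ℂ)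
    (h : ⊤ ≤ (Spec.map (CommRingCat.ofHom x) ≫ hU.fromSpec) ⁻¹ᵁ U) :
    evalOn (Spec.map (CommRingCat.ofHom x) ≫ hU.fromSpec) U h = x := by
  have := specMap_evalOn hU _ h
  rw [cancel_mono] at this
  exact congr($(Spec.map_injective this).hom)

lemma mem_basicOpen_iff {X : Scheme.{0}} {U : X.Opens} (p : Spec (.of ℂ) ⟶ X)
    (h : ⊤ ≤ p ⁻¹ᵁ U) (g : Γ(X, U)) : ⊤ ≤ p ⁻¹ᵁ X.basicOpen g ↔ evalOn p U h g ≠ 0 := by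
  have h1 : p ⁻¹ᵁ X.basicOpen g = (Spec (.of ℂ)).basicOpen (p.appLE U ⊤ h g) := by
    rw [Scheme.basicOpen_appLE, top_inf_eq]
  have h2 : evalOn p U h g = (Scheme.ΓSpecIso (.of ℂ)).hom (p.appLE U ⊤ h g) := rfl
  rw [h1, h2, basicOpen_eq_of_affine']
  refine ⟨fun h h0 ↦ ?_, fun h x _ hx ↦ ?_⟩
  · rw [h0] at h
    exact h (x := IsLocalRing.closedPoint ℂ) trivial (zero_mem _)
  · exact x.2.ne_top (Ideal.eq_top_of_isUnit_mem _ hx (isUnit_iff_ne_zero.mpr h))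

lemma le_preimage_top {X Y : Scheme.{0}} (f : X ⟶ Y) (U : X.Opens) : U ≤ f ⁻¹ᵁ ⊤ := le_top

/-- The homomorphism from `ℂ` to the sections over an open subset of a complex scheme. -/
def structureMap (Z : Over (Spec (.of ℂ))) (U : Z.left.Opens) : ℂ →+* Γ(Z.left, U) :=
  ((Scheme.ΓSpecIso (.of ℂ)).inv ≫ Z.hom.appLE ⊤ U (le_preimage_top _ _)).hom

/-- The `ℂ`-algebra of sections over an open subset of a complex scheme. -/
def Sections (Z : Over (Spec (.of ℂ))) (U : Z.left.Opens) : Type := Γ(Z.left, U)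

instance (Z : Over (Spec (.of ℂ))) (U : Z.left.Opens) : CommRing (Sections Z U) :=
  inferInstanceAs (CommRing Γ(Z.left, U))

instance (Z : Over (Spec (.of ℂ))) (U : Z.left.Opens) : Algebra ℂ (Sections Z U) :=
  (structureMap Z U).toAlgebra

lemma evalOn_structureMap {Z : Over (Spec (.of ℂ))} {U : Z.left.Opens}
    (p : Spec (.of ℂ) ⟶ Z.left) (hp : p ≫ Z.hom = 𝟙 _) (h : ⊤ ≤ p ⁻¹ᵁ U) :
    (evalOn p U h).comp (structureMap Z U) = RingHom.id ℂ := by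
  have key : Z.hom.appLE ⊤ U (le_preimage_top _ _) ≫ p.appLE U ⊤ h = 𝟙 _ := by
    rw [Scheme.Hom.appLE_comp_appLE]
    have (q : Spec (.of ℂ) ⟶ Spec (.of ℂ)) (hq : q = 𝟙 _) (e : ⊤ ≤ q ⁻¹ᵁ ⊤) :
        q.appLE ⊤ ⊤ e = 𝟙 _ := by
      subst hq
      exact (Scheme.Hom.appLE_eq_app _).trans (Scheme.Hom.id_app _)
    exact this _ hp _
  have h2 : (Scheme.ΓSpecIso (.of ℂ)).inv ≫ (Z.hom.appLE ⊤ U (le_preimage_top _ _) ≫ p.appLE U ⊤ h) ≫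
      (Scheme.ΓSpecIso (.of ℂ)).hom = 𝟙 _ := by
    rw [key, Category.id_comp, Iso.inv_hom_id]
  exact congr($(h2).hom)

lemma fromSpec_comp_hom {Z : Over (Spec (.of ℂ))} {U : Z.left.Opens} (hU : IsAffineOpen U) :
    hU.fromSpec ≫ Z.hom = Spec.map (CommRingCat.ofHom (structureMap Z U)) := by
  have : CommRingCat.ofHom (structureMap Z U) =
    (Scheme.ΓSpecIso (.of ℂ)).inv ≫ Z.hom.appLE ⊤ U (le_preimage_top _ _) := rfl
  rw [this, Spec.map_comp, ← IsAffineOpen.SpecMap_appLE_fromSpec Z.hom (isAffineOpen_top _) hU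
      (le_preimage_top _ _),
    IsAffineOpen.fromSpec_top]
  simp [Scheme.isoSpec_Spec]

namespace ComplexPoints

variable {Z : Over (Spec (.of ℂ))} {U : Z.left.Opens} (hU : IsAffineOpen U)

lemma left_comp_hom (p : ComplexPoints Z) : p.left ≫ Z.hom = 𝟙 _ := Over.w p

/-- A complex point of the ring of sections, as a ring homomorphism. -/
def sectionsHom (x : AffinePoints (Sections Z U)) : Γ(Z.left, U) →+* ℂ := (x : Sections Z U →+* ℂ)

lemma sectionsHom_comp (x : AffinePoints (Sections Z U)) :
    (sectionsHom x).comp (structureMap Z U) = RingHom.id ℂ := by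
  ext v
  exact AlgHomClass.commutes x v

/-- A complex point of an affine open subset, as a point of the whole scheme. -/
def ofAffinePoint (x : AffinePoints (Sections Z U)) : ComplexPoints Z :=
  Over.homMk (Spec.map (CommRingCat.ofHom (sectionsHom x)) ≫ hU.fromSpec) <| by
    change _ = 𝟙 _
    rw [Category.assoc, fromSpec_comp_hom, ← Spec.map_comp, ← CommRingCat.ofHom_comp, sectionsHom_comp]
    exact Spec.map_id _

lemma top_le_ofAffinePoint (x : AffinePoints (Sections Z U)) :
    ⊤ ≤ (ofAffinePoint hU x).left ⁻¹ᵁ U := top_le_preimage_specMap hU _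

lemma evalOn_ofAffinePoint (x : AffinePoints (Sections Z U)) (h) (c : Γ(Z.left, U)) :
    evalOn (ofAffinePoint hU x).left U h c = x c :=
  congr($(evalOn_specMap hU (sectionsHom x) h) c)

/-- The evaluation of sections over an open set at a complex point of that set. -/
def toAffinePoint (p : ComplexPoints Z) (h : ⊤ ≤ p.left ⁻¹ᵁ U) : AffinePoints (Sections Z U) :=
  (AlgHom.mk (evalOn p.left U h) fun v ↦ congr($(evalOn_structureMap p.left (left_comp_hom p) h) v) :
    Sections Z U →ₐ[ℂ] ℂ)

lemma ofAffinePoint_toAffinePoint (p : ComplexPoints Z) (h : ⊤ ≤ p.left ⁻¹ᵁ U) :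
    ofAffinePoint hU (toAffinePoint p h) = p :=
  Over.OverMorphism.ext <| show Spec.map (CommRingCat.ofHom (evalOn p.left U h)) ≫ hU.fromSpec = _ from
    (specMap_evalOn hU p.left h)

lemma range_ofAffinePoint : Set.range (ofAffinePoint hU) = {p | ⊤ ≤ p.left ⁻¹ᵁ U} := by
  ext p
  refine ⟨?_, fun h ↦ ⟨toAffinePoint p h, ofAffinePoint_toAffinePoint hU p h⟩⟩
  rintro ⟨x, rfl⟩
  exact top_le_ofAffinePoint hU x

lemma injective_ofAffinePoint : Function.Injective (ofAffinePoint hU) := fun x x' h ↦ by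
  ext c
  refine (evalOn_ofAffinePoint hU x (top_le_ofAffinePoint hU x) c).symm.trans
    (Eq.trans ?_ (evalOn_ofAffinePoint hU x' (top_le_ofAffinePoint hU x') c))
  simp only [h]

lemma mem_basicSet_iff {U : Z.left.Opens} (f : Γ(U, ⊤)) (V : Set ℂ) (p : ComplexPoints Z) :
    p ∈ basicSet U f V ↔ ∃ h : ⊤ ≤ p.left ⁻¹ᵁ U, evalOn p.left U h (U.topIso.hom f) ∈ V := by
  refine ⟨?_, fun ⟨h, hf⟩ ↦ ?_⟩
  · rintro ⟨y, hy, hf⟩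
    have h := (exists_lift_iff p.left U).mp ⟨y, hy⟩
    refine ⟨h, ?_⟩
    simp only [← hy] at h ⊢
    rwa [← evalAt_eq]
  · obtain ⟨y, hy⟩ := (exists_lift_iff p.left U).mpr h
    refine ⟨y, hy, ?_⟩
    simp only [← hy] at h hf
    rwa [← evalAt_eq] at hf

lemma isOpen_basicSet (U : Z.left.Opens) (f : Γ(U, ⊤)) {V : Set ℂ} (hV : IsOpen V) :
    IsOpen (basicSet U f V) := TopologicalSpace.isOpen_generateFrom_of_mem ⟨U, f, V, hV, rfl⟩

lemma isOpen_setOf_top_le (U : Z.left.Opens) : IsOpen {p : ComplexPoints Z | ⊤ ≤ p.left ⁻¹ᵁ U} := by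
  convert isOpen_basicSet U 0 isOpen_univ using 1
  ext p
  simp [mem_basicSet_iff]

/-- Near a point, a regular function on another open set has the form `a / g ^ n` with `a` and `g`
regular on `U` and `g` non-zero there, so it is continuous for pointwise convergence. -/
lemma continuous_ofAffinePoint : Continuous (ofAffinePoint hU) := by
  refine continuous_generateFrom_iff.mpr ?_
  rintro _ ⟨U', f, V, hV, rfl⟩
  rw [isOpen_iff_mem_nhds]
  intro x hx
  rw [Set.mem_preimage, mem_basicSet_iff] at hx
  obtain ⟨h', hf⟩ := hx
  obtain ⟨g, hgU', hg⟩ := hU.exists_basicOpen_le ⟨_, (top_le_preimage_iff _ U').mp h'⟩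
    ((top_le_preimage_iff _ U).mp (top_le_ofAffinePoint hU x))
  have := hU.isLocalization_basicOpen g
  obtain ⟨n, a, hna⟩ := IsLocalization.Away.surj g
    (Z.left.presheaf.map (homOfLE hgU').op (U'.topIso.hom f))
  have hD (x' : AffinePoints (Sections Z U)) : ⊤ ≤ (ofAffinePoint hU x').left ⁻¹ᵁ
      Z.left.basicOpen g ↔ x' g ≠ 0 := by
    rw [mem_basicOpen_iff _ (top_le_ofAffinePoint hU x'), evalOn_ofAffinePoint]
  have hval (x' : AffinePoints (Sections Z U)) (hg' : x' g ≠ 0)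
      (h : ⊤ ≤ (ofAffinePoint hU x').left ⁻¹ᵁ U') :
      evalOn (ofAffinePoint hU x').left U' h (U'.topIso.hom f) = x' a / x' g ^ n := by
    rw [← evalOn_map _ ((hD x').mpr hg') hgU', eq_div_iff (pow_ne_zero n hg')]
    have := congr(evalOn (ofAffinePoint hU x').left _ ((hD x').mpr hg') $hna)
    rw [map_mul, map_pow] at this
    have hmap (c : Γ(Z.left, U)) : evalOn (ofAffinePoint hU x').left _ ((hD x').mpr hg')
        (algebraMap Γ(Z.left, U) Γ(Z.left, Z.left.basicOpen g) c) = x' c :=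
      (evalOn_map _ ((hD x').mpr hg') (Z.left.basicOpen_le g) c).trans
        (evalOn_ofAffinePoint hU x' _ c)
    rwa [hmap, hmap] at this
  have hx0 : x g ≠ 0 := (hD x).mp ((top_le_preimage_iff _ _).mpr hg)
  have hcont : ContinuousAt (fun x' : AffinePoints (Sections Z U) ↦ x' a / x' g ^ n) x :=
    (AffinePoints.continuous_eval _).continuousAt.div
      ((AffinePoints.continuous_eval _).pow n).continuousAt (pow_ne_zero n hx0)
  rw [hval x hx0] at hf
  filter_upwards [(AffinePoints.continuous_eval (C := Sections Z U) g).continuousAt.eventually_ne hx0,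
    hcont (hV.mem_nhds hf)] with x' hx' hxV
  rw [Set.mem_preimage, mem_basicSet_iff]
  have h : ⊤ ≤ (ofAffinePoint hU x').left ⁻¹ᵁ U' :=
    ((hD x').mpr hx').trans (Scheme.Hom.preimage_mono _ hgU')
  exact ⟨h, hval x' hx' h ▸ hxV⟩

/-- The complex points of an affine open subset, with the topology of pointwise convergence of
regular functions, form an open subspace of all complex points. -/
lemma isOpenEmbedding_ofAffinePoint : IsOpenEmbedding (ofAffinePoint hU) := by
  refine ⟨⟨isInducing_iff_nhds.mpr fun x ↦ le_antisymm ?_ ?_, injective_ofAffinePoint hU⟩, ?_⟩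
  · exact (continuous_ofAffinePoint hU).continuousAt.tendsto.le_comap
  · refine tendsto_id'.mp
      ((AffinePoints.tendsto_nhds_iff (C := Sections Z U) (f := id)).mpr fun c ↦ ?_)
    refine (nhds_basis_opens (x c)).tendsto_right_iff.mpr fun V ⟨hxV, hV⟩ ↦ ?_
    have key (x' : AffinePoints (Sections Z U)) (h : ⊤ ≤ (ofAffinePoint hU x').left ⁻¹ᵁ U) :
        evalOn (ofAffinePoint hU x').left U h (U.topIso.hom (U.topIso.inv c)) = x' c :=
      (congr_arg _ (U.topIso.inv_hom_id_apply c)).trans (evalOn_ofAffinePoint hU x' h c)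
    refine ⟨_, (isOpen_basicSet U (U.topIso.inv c) hV).mem_nhds ((mem_basicSet_iff _ _ _).mpr
      ⟨top_le_ofAffinePoint hU x, Set.mem_of_eq_of_mem (key x _) hxV⟩), fun x' hx' ↦ ?_⟩
    obtain ⟨h, hx'⟩ := (mem_basicSet_iff _ _ _).mp hx'
    exact show x' c ∈ V from Set.mem_of_eq_of_mem (key x' h).symm hx'
  · rw [range_ofAffinePoint]
    exact isOpen_setOf_top_le U

end ComplexPoints

/-! ### From affine open subsets to schemes -/

/-- The restriction of a map to open subspaces determines whether it is a covering map over
the open subspace of the target. -/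
lemma isCoveringMapOn_range_iff {E X E' X' : Type*} [TopologicalSpace E] [TopologicalSpace X]
    [TopologicalSpace E'] [TopologicalSpace X'] {f : E → X} {f' : E' → X'} {e : E' → E} {i : X' → X}
    (he : IsOpenEmbedding e) (hi : IsOpenEmbedding i) (hc : ∀ z, f (e z) = i (f' z))
    (hr : Set.range e = f ⁻¹' Set.range i) :
    IsCoveringMapOn f (Set.range i) ↔ IsCoveringMap f' := by
  let a : E' ≃ₜ f ⁻¹' Set.range i := he.toHomeomorph.trans (.setCongr hr)
  let b : X' ≃ₜ Set.range i := hi.toHomeomorph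
  have hab : (Set.range i).restrictPreimage f ∘ a = b ∘ f' := by
    ext z
    exact hc z
  have : IsCoveringMap ((Set.range i).restrictPreimage f) ↔ IsCoveringMap f' := by
    rw [← IsCoveringMap.comp_homeomorph_iff a, hab, IsCoveringMap.homeomorph_comp_iff]
  rw [← this]
  exact ⟨fun h ↦ h.isCoveringMap_restrictPreimage,
    fun h ↦ .of_isCoveringMap_restrictPreimage _ hi.isOpen_range (hr ▸ he.isOpen_range) h⟩

section

variable {Z W : Over (Spec (.of ℂ))} (f : Z ⟶ W) (U : W.left.Opens)

lemma app_comp_structureMap :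
    (f.left.app U).hom.comp (structureMap W U) = structureMap Z (f.left ⁻¹ᵁ U) := by
  have : W.hom.appLE ⊤ U (le_preimage_top _ _) ≫ f.left.app U =
      Z.hom.appLE ⊤ (f.left ⁻¹ᵁ U) (le_preimage_top _ _) := by
    rw [Scheme.Hom.app_eq_appLE, Scheme.Hom.appLE_comp_appLE]
    simp only [Over.w]
  exact congr(((Scheme.ΓSpecIso (.of ℂ)).inv ≫ $this).hom)

/-- The pullback of sections, as an algebra structure. -/
@[reducible]
def sectionsAlgebra : Algebra (Sections W U) (Sections Z (f.left ⁻¹ᵁ U)) :=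
  (f.left.app U).hom.toAlgebra

lemma isScalarTower_sections : letI := sectionsAlgebra f U
    IsScalarTower ℂ (Sections W U) (Sections Z (f.left ⁻¹ᵁ U)) :=
  letI := sectionsAlgebra f U
  IsScalarTower.of_algebraMap_eq fun v ↦ (congr($(app_comp_structureMap f U) v)).symm

lemma finiteType_sections [LocallyOfFiniteType W.hom] (hU : IsAffineOpen U) :
    Algebra.FiniteType ℂ (Sections W U) := by
  have := W.hom.finiteType_appLE (isAffineOpen_top _) hU (le_preimage_top _ _)
  exact this.comp (RingHom.FiniteType.of_surjective _
    (Scheme.ΓSpecIso (.of ℂ)).symm.commRingCatIsoToRingEquiv.surjective)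

/-- Being a covering map over an affine open subset is an algebraic property. -/
lemma isCoveringMapOn_iff [IsFinite f.left] [LocallyOfFiniteType W.hom] (hU : IsAffineOpen U) :
    IsCoveringMapOn (complexPointsMap f) {p | ⊤ ≤ p.left ⁻¹ᵁ U} ↔
      letI := (f.left.app U).hom.toAlgebra
      IsCoverSetTheoretically Γ(W.left, U) Γ(Z.left, f.left ⁻¹ᵁ U) (structureMap W U) := by
  let := sectionsAlgebra f U
  have := isScalarTower_sections f U
  have := finiteType_sections U hU
  have hfin : Module.Finite (Sections W U) (Sections Z (f.left ⁻¹ᵁ U)) := f.left.finite_app U hU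
  have hV : IsAffineOpen (f.left ⁻¹ᵁ U) := hU.preimage f.left
  refine Iff.trans ?_ (AffinePoints.isCoveringMap_restrict_iff (A := Sections W U)
    (B := Sections Z (f.left ⁻¹ᵁ U)))
  rw [← ComplexPoints.range_ofAffinePoint hU]
  refine isCoveringMapOn_range_iff (ComplexPoints.isOpenEmbedding_ofAffinePoint hV)
    (ComplexPoints.isOpenEmbedding_ofAffinePoint hU) (fun z ↦ ?_) ?_
  · apply Over.OverMorphism.ext
    change (Spec.map (CommRingCat.ofHom (ComplexPoints.sectionsHom z)) ≫ hV.fromSpec) ≫ f.left =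
      Spec.map (f.left.app U ≫ CommRingCat.ofHom (ComplexPoints.sectionsHom z)) ≫ hU.fromSpec
    rw [Category.assoc, Spec.map_comp, Category.assoc, Scheme.Hom.app_eq_appLE,
      IsAffineOpen.SpecMap_appLE_fromSpec f.left hU hV le_rfl]
  · rw [ComplexPoints.range_ofAffinePoint, ComplexPoints.range_ofAffinePoint]
    rfl

end

lemma isCoveringMap_iff_forall_isAffineOpen {Z W : Over (Spec (.of ℂ))} (f : Z ⟶ W) :
    IsCoveringMap (complexPointsMap f) ↔ ∀ U : W.left.Opens, IsAffineOpen U →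
      IsCoveringMapOn (complexPointsMap f) {p | ⊤ ≤ p.left ⁻¹ᵁ U} := by
  refine ⟨fun h U _ x _ ↦ h x, fun h p ↦ ?_⟩
  obtain ⟨U, hU, hp, -⟩ := exists_isAffineOpen_mem_and_subset
    (U := ⊤) (x := p.left (IsLocalRing.closedPoint ℂ)) trivial
  exact h U hU p ((top_le_preimage_iff _ _).mpr hp)

/-! ### Automorphisms of `ℂ` relating two embeddings -/

/-- Uncountable algebraically closed extensions of the same cardinality of a countable field are
isomorphic. -/
lemma nonempty_algEquiv_of_isAlgClosed {k K L : Type} [Field k] [Field K] [Field L] [Algebra k K]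
    [Algebra k L] [IsAlgClosed K] [IsAlgClosed L] (hk : Cardinal.mk k ≤ Cardinal.aleph0)
    (hK : Cardinal.aleph0 < Cardinal.mk K) (hKL : Cardinal.mk K = Cardinal.mk L) :
    Nonempty (K ≃ₐ[k] L) := by
  obtain ⟨s, hs⟩ := exists_isTranscendenceBasis k K
  obtain ⟨t, ht⟩ := exists_isTranscendenceBasis k L
  -- Over a countable field, a transcendence basis of an uncountable algebraically closed field has
  -- the cardinality of that field.
  have hst : Cardinal.mk s = Cardinal.mk t := by
    rw [← IsAlgClosed.cardinal_eq_cardinal_transcendence_basis_of_aleph0_lt' _ hs hk hK,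
      ← IsAlgClosed.cardinal_eq_cardinal_transcendence_basis_of_aleph0_lt' _ ht hk (hKL ▸ hK), hKL]
  obtain ⟨e⟩ := Cardinal.eq.mp hst
  have := IsAlgClosed.isAlgClosure_of_transcendence_basis _ hs
  have := IsAlgClosed.isAlgClosure_of_transcendence_basis _ ht
  let a : Algebra.adjoin k (Set.range ((↑) : s → K)) ≃ₐ[k]
      Algebra.adjoin k (Set.range ((↑) : t → L)) :=
    hs.1.aevalEquiv.symm.trans ((MvPolynomial.renameEquiv k e).trans ht.1.aevalEquiv)
  refine ⟨AlgEquiv.ofRingEquiv (f := IsAlgClosure.equivOfEquiv K L a.toRingEquiv) fun r ↦ ?_⟩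
  have h := IsAlgClosure.equivOfEquiv_algebraMap K L a.toRingEquiv (algebraMap k _ r)
  rw [← IsScalarTower.algebraMap_apply] at h
  rw [h, IsScalarTower.algebraMap_apply k (Algebra.adjoin k (Set.range ((↑) : t → L))) L]
  exact congr_arg _ (a.commutes r)

/-- Two complex embeddings of a number field differ by an automorphism of the complex numbers. -/
lemma exists_ringEquiv_comp_eq {k : Type} [Field k] [NumberField k] (φ ψ : k →+* ℂ) :
    ∃ τ : ℂ ≃+* ℂ, (τ : ℂ →+* ℂ).comp φ = ψ := by
  have hk : Cardinal.mk k ≤ Cardinal.aleph0 :=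
    (Algebra.IsAlgebraic.cardinalMk_le_max ℚ k).trans (by simp)
  obtain ⟨e⟩ := @nonempty_algEquiv_of_isAlgClosed k ℂ ℂ _ _ _ φ.toAlgebra ψ.toAlgebra _ _ hk
    (by simpa using Cardinal.cantor Cardinal.aleph0) rfl
  let := φ.toAlgebra
  exact ⟨@AlgEquiv.toRingEquiv k ℂ ℂ _ _ _ φ.toAlgebra ψ.toAlgebra e,
    RingHom.ext fun r ↦ @AlgEquiv.commutes k ℂ ℂ _ _ _ φ.toAlgebra ψ.toAlgebra e r⟩

/-! ### Finiteness conditions, change of structure map and base change -/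

instance (k : Type) [Field k] (n : ℕ) : LocallyOfFiniteType (projectiveSpace k n).hom := by
  let : GradedAlgebra (MvPolynomial.homogeneousSubmodule (Fin (n + 1)) k) :=
    MvPolynomial.gradedAlgebra
  have h0 : Function.Surjective
      (algebraMap k (MvPolynomial.homogeneousSubmodule (Fin (n + 1)) k 0)) := by
    rintro ⟨p, hp⟩
    obtain ⟨c, rfl⟩ : ∃ c, MvPolynomial.C c = p :=
      ⟨_, (MvPolynomial.totalDegree_eq_zero_iff_eq_C.mp
        ((MvPolynomial.totalDegree_zero_iff_isHomogeneous _).mpr hp)).symm⟩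
    exact ⟨c, Subtype.ext rfl⟩
  have : LocallyOfFiniteType (Spec.map (CommRingCat.ofHom
      (algebraMap k (MvPolynomial.homogeneousSubmodule (Fin (n + 1)) k 0)))) :=
    (HasRingHomProperty.Spec_iff (P := @LocallyOfFiniteType)).mpr (.of_surjective _ h0)
  have : Algebra.FiniteType (MvPolynomial.homogeneousSubmodule (Fin (n + 1)) k 0)
      (MvPolynomial (Fin (n + 1)) k) :=
    RingHom.FiniteType.of_comp_finiteType
      (f := algebraMap k (MvPolynomial.homogeneousSubmodule (Fin (n + 1)) k 0))
      (RingHom.finiteType_algebraMap.mpr (inferInstanceAs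
        (Algebra.FiniteType k (MvPolynomial (Fin (n + 1)) k))))
  exact inferInstanceAs (LocallyOfFiniteType
    (Proj.toSpecZero (MvPolynomial.homogeneousSubmodule (Fin (n + 1)) k) ≫
    Spec.map (CommRingCat.ofHom
      (algebraMap k (MvPolynomial.homogeneousSubmodule (Fin (n + 1)) k 0)))))

lemma IsQuasiProjective.locallyOfFiniteType {k : Type} [Field k] {X : Over (Spec (.of k))}
    (hX : IsQuasiProjective X) : LocallyOfFiniteType X.hom := by
  obtain ⟨n, i, hi⟩ := hX
  rw [← Over.w i]
  infer_instance

lemma continuous_complexPointsMap {Z W : Over (Spec (.of ℂ))} (f : Z ⟶ W) :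
    Continuous (complexPointsMap f) := by
  refine continuous_generateFrom_iff.mpr ?_
  rintro _ ⟨U, c, V, hV, rfl⟩
  convert ComplexPoints.isOpen_basicSet (f.left ⁻¹ᵁ U)
    ((f.left ⁻¹ᵁ U).topIso.inv (f.left.appLE U _ le_rfl (U.topIso.hom c))) hV using 1
  ext p
  rw [Set.mem_preimage, ComplexPoints.mem_basicSet_iff, ComplexPoints.mem_basicSet_iff]
  refine exists_congr fun h ↦ ?_
  rw [Iso.inv_hom_id_apply]
  exact iff_of_eq congr($(evalOn_comp p.left f.left U h (f.left ⁻¹ᵁ U) h le_rfl) (U.topIso.hom c) ∈ V)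

/-- Isomorphic complex schemes have homeomorphic spaces of complex points. -/
def complexPointsHomeomorph {Z W : Over (Spec (.of ℂ))} (e : Z ≅ W) :
    ComplexPoints Z ≃ₜ ComplexPoints W where
  toFun := complexPointsMap e.hom
  invFun := complexPointsMap e.inv
  left_inv p := (Category.assoc _ _ _).trans (congr(p ≫ $(e.hom_inv_id)).trans (Category.comp_id _))
  right_inv p := (Category.assoc _ _ _).trans (congr(p ≫ $(e.inv_hom_id)).trans (Category.comp_id _))
  continuous_toFun := continuous_complexPointsMap _
  continuous_invFun := continuous_complexPointsMap _

lemma isTopologicalCover_iff {Z W : Over (Spec (.of ℂ))} (f : Z ⟶ W) :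
    IsTopologicalCover (complexPointsMap f) ↔
      Function.Surjective (complexPointsMap f) ∧ IsCoveringMap (complexPointsMap f) :=
  and_iff_right (continuous_complexPointsMap f)

lemma isTopologicalCover_map_iff {C : Type*} [Category C] {F G : C ⥤ Over (Spec (.of ℂ))}
    (α : F ≅ G) {Y X : C} (π : Y ⟶ X) : IsTopologicalCover (complexPointsMap (F.map π)) ↔
      IsTopologicalCover (complexPointsMap (G.map π)) := by
  have h : complexPointsHomeomorph (α.app X) ∘ complexPointsMap (F.map π) =
      complexPointsMap (G.map π) ∘ complexPointsHomeomorph (α.app Y) := by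
    ext p
    exact (Category.assoc _ _ _).trans (congr(p ≫ $(α.hom.naturality π)).trans
      (Category.assoc _ _ _).symm)
  rw [isTopologicalCover_iff, isTopologicalCover_iff,
    ← EquivLike.comp_surjective _ (complexPointsHomeomorph (α.app X)),
    ← IsCoveringMap.homeomorph_comp_iff (complexPointsHomeomorph (α.app X)), h,
    EquivLike.surjective_comp, IsCoveringMap.comp_homeomorph_iff]

/-- The automorphism of `Spec ℂ` defined by an automorphism of the complex numbers. -/
def specIso (τ : ℂ ≃+* ℂ) : Spec (.of ℂ) ≅ Spec (.of ℂ) where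
  hom := Spec.map (CommRingCat.ofHom (τ : ℂ →+* ℂ))
  inv := Spec.map (CommRingCat.ofHom (τ.symm : ℂ →+* ℂ))
  hom_inv_id := by
    rw [← Spec.map_comp, ← CommRingCat.ofHom_comp, RingEquiv.comp_symm]
    exact Spec.map_id _
  inv_hom_id := by
    rw [← Spec.map_comp, ← CommRingCat.ofHom_comp, RingEquiv.symm_comp]
    exact Spec.map_id _

lemma structureMap_map (τ : ℂ ≃+* ℂ) (Z : Over (Spec (.of ℂ))) (U : Z.left.Opens) :
    structureMap ((Over.map (specIso τ).hom).obj Z) U = (structureMap Z U).comp (τ : ℂ →+* ℂ) := by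
  have h : (Scheme.ΓSpecIso (.of ℂ)).inv ≫ (Z.hom ≫ (specIso τ).hom).appLE ⊤ U
      (le_preimage_top _ _) = CommRingCat.ofHom (τ : ℂ →+* ℂ) ≫ (Scheme.ΓSpecIso (.of ℂ)).inv ≫
      Z.hom.appLE ⊤ U (le_preimage_top _ _) := by
    rw [← Category.assoc, Scheme.ΓSpecIso_inv_naturality, Category.assoc, Scheme.Hom.comp_appLE]
    rfl
  exact congr(($h).hom)

/-- Points of the twisted scheme are the original points precomposed with an automorphism of `Spec
ℂ`, compatibly with `f`; continuity of this bijection is not needed. -/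
lemma surjective_complexPointsMap_map (τ : ℂ ≃+* ℂ) {Z W : Over (Spec (.of ℂ))} {f : Z ⟶ W}
    (hf : Function.Surjective (complexPointsMap f)) :
    Function.Surjective (complexPointsMap ((Over.map (specIso τ).hom).map f)) := by
  intro q
  have hq : q.left ≫ W.hom ≫ (specIso τ).hom = 𝟙 _ := Over.w q
  have hq' : q.left ≫ W.hom = (specIso τ).inv := by
    rw [← cancel_mono (specIso τ).hom, Category.assoc, hq, Iso.inv_hom_id]
  obtain ⟨r, hr⟩ := hf (Over.homMk ((specIso τ).hom ≫ q.left) (by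
    change (_ ≫ q.left) ≫ W.hom = 𝟙 _
    rw [Category.assoc, hq', Iso.hom_inv_id]))
  have hr1 : r.left ≫ Z.hom = 𝟙 _ := Over.w r
  have hr2 : r.left ≫ f.left = (specIso τ).hom ≫ q.left := congr(($hr).left)
  refine ⟨Over.homMk ((specIso τ).inv ≫ r.left) ?_, Over.OverMorphism.ext ?_⟩
  · change (_ ≫ r.left) ≫ Z.hom ≫ (specIso τ).hom = 𝟙 _
    rw [Category.assoc, reassoc_of% hr1, Iso.inv_hom_id]
  · change ((specIso τ).inv ≫ r.left) ≫ f.left = q.left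
    rw [Category.assoc, hr2, Iso.inv_hom_id_assoc]

/-- Topological covers are preserved when the structure map of a finite morphism of complex schemes
is changed by an automorphism of the complex numbers. -/
lemma IsTopologicalCover.map_specIso (τ : ℂ ≃+* ℂ) {Z W : Over (Spec (.of ℂ))} {f : Z ⟶ W}
    [IsFinite f.left] [LocallyOfFiniteType W.hom] (hf : IsTopologicalCover (complexPointsMap f)) :
    IsTopologicalCover (complexPointsMap ((Over.map (specIso τ).hom).map f)) := by
  rw [isTopologicalCover_iff] at hf ⊢
  refine ⟨surjective_complexPointsMap_map τ hf.1, ?_⟩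
  have : IsFinite ((Over.map (specIso τ).hom).map f).left := ‹IsFinite f.left›
  have : LocallyOfFiniteType ((Over.map (specIso τ).hom).obj W).hom :=
    inferInstanceAs (LocallyOfFiniteType (W.hom ≫ (specIso τ).hom))
  rw [isCoveringMap_iff_forall_isAffineOpen] at hf ⊢
  intro U hU
  let := (f.left.app U).hom.toAlgebra
  refine (isCoveringMapOn_iff ((Over.map (specIso τ).hom).map f) U hU).mpr ?_
  rw [structureMap_map]
  exact ((isCoveringMapOn_iff f U hU).mp (hf.2 U hU)).comp τ

/-- Base change along an isomorphism changes the structure map by its inverse. -/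
def pullbackIso {S T : Scheme.{0}} (e : S ≅ T) : Over.pullback e.hom ≅ Over.map e.inv :=
  (Over.mapPullbackAdj e.hom).rightAdjointUniq (Over.mapIso e).toAdjunction

/-- Extension of scalars along a composite is an iterated extension of scalars. -/
def baseChangeComp {K L M : Type} [Field K] [Field L] [Field M] (φ : K →+* L) (ψ : L →+* M) :
    baseChange (ψ.comp φ) ≅ baseChange φ ⋙ baseChange ψ :=
  eqToIso (by
    have h : Spec.map (CommRingCat.ofHom (ψ.comp φ)) =
        Spec.map (CommRingCat.ofHom ψ) ≫ Spec.map (CommRingCat.ofHom φ) := Spec.map_comp _ _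
    simp only [baseChange, h]) ≪≫ Over.pullbackComp _ _

instance {K L : Type} [Field K] [Field L] (φ : K →+* L) (X : Over (Spec (.of K)))
    [LocallyOfFiniteType X.hom] : LocallyOfFiniteType ((baseChange φ).obj X).hom :=
  inferInstanceAs (LocallyOfFiniteType (Limits.pullback.snd _ _))

instance {K L : Type} [Field K] [Field L] (φ : K →+* L) {X Y : Over (Spec (.of K))} (π : Y ⟶ X)
    [h : IsFinite π.left] : IsFinite ((baseChange φ).map π).left :=
  MorphismProperty.overPullbackMap (P := @IsFinite) _ π h

/-- With `ψ = τ ∘ φ`, the base change along `ψ` is that along `φ` with its structure map composed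
with `Spec` of `τ⁻¹`; hence `τ.symm` below. -/
lemma IsTopologicalCover.of_embedding {k : Type} [Field k] [NumberField k]
    {X Y : Over (Spec (.of k))} [LocallyOfFiniteType X.hom] (π : Y ⟶ X) [IsFinite π.left]
    {φ : k →+* ℂ} (h : IsTopologicalCover (complexPointsMap ((baseChange φ).map π)))
    (ψ : k →+* ℂ) : IsTopologicalCover (complexPointsMap ((baseChange ψ).map π)) := by
  obtain ⟨τ, rfl⟩ := exists_ringEquiv_comp_eq φ ψ
  exact (isTopologicalCover_map_iff (baseChangeComp φ (τ : ℂ →+* ℂ) ≪≫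
    Functor.isoWhiskerLeft _ (pullbackIso (specIso τ))) π).mpr (h.map_specIso τ.symm)

end ChevalleyWeil

end

theorem mainTheorem5 (k : Type) [Field k] [NumberField k]
    (X Y : Over (Spec (.of k)))
    (hX : ChevalleyWeil.IsQuasiProjective X) (hY : ChevalleyWeil.IsQuasiProjective Y)
    (π : Y ⟶ X) (hfin : IsFinite π.left) (hdom : IsDominant π.left) :
    (∀ (ι : k →+* AlgebraicClosure ℚ) (j : AlgebraicClosure ℚ →+* ℂ)
        (σ : AlgebraicClosure ℚ ≃ₐ[ℚ] AlgebraicClosure ℚ),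
      ChevalleyWeil.IsTopologicalCover (ChevalleyWeil.complexPointsMap
          ((ChevalleyWeil.baseChange (j.comp ι)).map π)) ↔
        ChevalleyWeil.IsTopologicalCover (ChevalleyWeil.complexPointsMap
          ((ChevalleyWeil.baseChange
              (j.comp ((σ : AlgebraicClosure ℚ →+* AlgebraicClosure ℚ).comp ι).fieldRange.subtype)).map
            ((ChevalleyWeil.conjugate ι
              (σ : AlgebraicClosure ℚ →+* AlgebraicClosure ℚ)).map π)))) ∧
    (∀ φ ψ : k →+* ℂ,
      ChevalleyWeil.IsTopologicalCover (ChevalleyWeil.complexPointsMap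
          ((ChevalleyWeil.baseChange φ).map π)) ↔
        ChevalleyWeil.IsTopologicalCover (ChevalleyWeil.complexPointsMap
          ((ChevalleyWeil.baseChange ψ).map π))) := by
  have := hX.locallyOfFiniteType
  have key (φ ψ : k →+* ℂ) :
      ChevalleyWeil.IsTopologicalCover (ChevalleyWeil.complexPointsMap
          ((ChevalleyWeil.baseChange φ).map π)) ↔
        ChevalleyWeil.IsTopologicalCover (ChevalleyWeil.complexPointsMap
          ((ChevalleyWeil.baseChange ψ).map π)) :=
    ⟨fun h ↦ h.of_embedding π ψ, fun h ↦ h.of_embedding π φ⟩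
  -- Part (1) is the case of the embeddings `j ∘ ι` and `j ∘ σ ∘ ι`: the latter factors through the
  -- field `σ(k)`, so its base change is the conjugate followed by extension to `ℂ`.
  exact ⟨fun ι j σ ↦ (key _ _).trans
    (ChevalleyWeil.isTopologicalCover_map_iff (ChevalleyWeil.baseChangeComp _ _) π), key⟩
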